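/- Let $\gamma\in[1,2]$ and let $\bar\rho$ be the density of a liquid Lane--Emden star of adiabatic index $\gamma$ and radius $R>0$. That is, $\bar\rho(\mathbf x)=f(|\mathbf x|)$ for $|\mathbf x|\le R$ and $\bar\rho=0$ elsewhere, where $f\in C^2([0,R])$ is strictly decreasing with $f(R)=1$, $f'(0)=0$ and, on $(0,R)$, $$\frac{1}{r^{2}}\big(r^2 w'(r)\big)'+4\pi f(r)=0,\qquad w=\tfrac{\gamma}{\gamma-1}f^{\gamma-1}\ \text{ if }\gamma>1,\qquad w=\ln f\ \text{ if }\gamma=1.$$ Let $B_R\subset\mathbb R^3$ be the open ball of radius $R$ centred at $\mathbf 0$. Write $\langle\boldsymbol\theta_1,\boldsymbol\theta_2\rangle_{\bar\rho}=\int_{B_R}\bar\rho\,\boldsymbol\theta_1\cdot\boldsymbol\theta_2\,d\mathbf x$, write $\mathbf e_1,\mathbf e_2,\mathbf e_3$ for the standard basis of $\mathbb R^3$, and let $$H=\{\boldsymbol\theta\in H^2(B_R;\mathbb R^3):(\nabla\cdot\boldsymbol\theta)|_{\partial B_R}=0\}.$$ For $\boldsymbol\theta\in H$ let $$\mathbf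 L\boldsymbol\theta=-\nabla\Big(\gamma\bar\rho^{\gamma-2}\,\nabla\cdot(\bar\rho\boldsymbol\theta)-\int_{B_R}\frac{\nabla\cdot(\bar\rho\boldsymbol\theta)(\mathbf y)}{|\mathbf x-\mathbf y|}\,d\mathbf y+\int_{\partial B_R}\frac{\boldsymbol\theta(\mathbf z)}{|\mathbf x-\mathbf z|}\cdot d\mathbf S(\mathbf z)\Big)$$ be the linearised Euler--Poisson operator around $\bar\rho$. Then $\langle\mathbf L\boldsymbol\theta,\boldsymbol\theta\rangle_{\bar\rho}$ does not control $\|\nabla\boldsymbol\theta\|_{L^2(B_R)}^2$, even for irrotational fields orthogonal to the translations: there is no constant $c>0$ such that $$\langle\mathbf L\boldsymbol\theta,\boldsymbol\theta\rangle_{\bar\rho}\ \ge\ c\,\|\nabla\boldsymbol\theta\|_{L^2(B_R)}^2$$ for every $\boldsymbol\theta\in H$ that is irrotational on $B_R$ and satisfies $\langle\boldsymbol\theta,\mathbf e_i\rangle_{\bar\rho}=0$ for $i=1,2,3$. -/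

import Mathlib

open MeasureTheory Filter Topology
open scoped ContDiff

noncomputable section

namespace LiquidStar

/-- Three-dimensional Euclidean space. -/
abbrev E3 : Type := EuclideanSpace ℝ (Fin 3)

/-- The standard basis vectors of `ℝ³`. -/
def stdVec (i : Fin 3) : E3 := EuclideanSpace.single i 1

/-- The open ball `B_R` centred at the origin. -/
def ballR (R : ℝ) : Set E3 := Metric.ball 0 R

/-- The surface measure `dS` on `∂B_R`: the surface measure of the unit sphere, pushed forward by
`s ↦ R s` and multiplied by `R²`. -/
def surfaceMeasure (R : ℝ) : Measure E3 :=
  ENNReal.ofReal (R ^ 2) •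
    (Measure.toSphere (volume : Measure E3)).map
      (fun s : Metric.sphere (0 : E3) 1 => R • (s : E3))

/-! ### Liquid Lane--Emden stars -/

/-- The enthalpy-type function whose Laplacian enters the Lane--Emden equation:
`γ / (γ - 1) * s ^ (γ - 1)` for `γ ≠ 1`, and `log s` for `γ = 1`. -/
def enthalpy (γ s : ℝ) : ℝ :=
  if γ = 1 then Real.log s else γ / (γ - 1) * s ^ (γ - 1)

/-- `f` is, on `[0, R]`, the radial density of a liquid Lane--Emden star of adiabatic index `γ` and
radius `R`. Here `r⁻² (r² w')'` is the Laplacian of a radial function `w`. -/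
structure IsLaneEmdenProfile (γ R : ℝ) (f : ℝ → ℝ) : Prop where
  radius_pos : 0 < R
  contDiffOn : ContDiffOn ℝ 2 f (Set.Icc 0 R)
  strictAntiOn : StrictAntiOn f (Set.Icc 0 R)
  boundary_value : f R = 1
  deriv_zero : derivWithin f (Set.Icc 0 R) 0 = 0
  equation : ∀ r ∈ Set.Ioo 0 R,
    (r ^ 2)⁻¹ * deriv (fun s => s ^ 2 * deriv (fun t => enthalpy γ (f t)) s) r
      + 4 * Real.pi * f r = 0

/-- The density `ρ̄(x) = f(|x|)` on the closed ball of radius `R`, extended by zero. -/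
def density (R : ℝ) (f : ℝ → ℝ) : E3 → ℝ :=
  (Metric.closedBall (0 : E3) R).indicator (fun x => f ‖x‖)

/-- The weighted inner product `⟨u, w⟩_ρ̄ = ∫_{B_R} ρ̄ u · w dx`. -/
def weightedInner (R : ℝ) (f : ℝ → ℝ) (u w : E3 → E3) : ℝ :=
  ∫ x in ballR R, density R f x * inner ℝ (u x) (w x)

/-! ### Weak derivatives, Sobolev regularity and traces -/

/-- `u'` is the weak (Fréchet) derivative of `u` on the open set `Ω`. -/
def HasWeakFDerivOn {F : Type*} [NormedAddCommGroup F] [NormedSpace ℝ F]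
    (Ω : Set E3) (u : E3 → F) (u' : E3 → E3 →L[ℝ] F) : Prop :=
  LocallyIntegrableOn u Ω ∧ LocallyIntegrableOn u' Ω ∧
    ∀ φ : E3 → ℝ, ContDiff ℝ ∞ φ → HasCompactSupport φ → tsupport φ ⊆ Ω →
      ∀ e : E3, ∫ x in Ω, fderiv ℝ φ x e • u x = - ∫ x in Ω, φ x • u' x e

/-- `u` belongs to `H¹(B_R)` and has trace `t ∈ L²(∂B_R)`: there are smooth functions that converge
to `u` in `H¹(B_R)` and whose restrictions to `∂B_R` converge to `t` in `L²(∂B_R)`. -/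
def HasTrace {F : Type*} [NormedAddCommGroup F] [NormedSpace ℝ F]
    (R : ℝ) (u t : E3 → F) : Prop :=
  MemLp u 2 (volume.restrict (ballR R)) ∧ MemLp t 2 (surfaceMeasure R) ∧
    ∃ u' : E3 → E3 →L[ℝ] F,
      HasWeakFDerivOn (ballR R) u u' ∧ MemLp u' 2 (volume.restrict (ballR R)) ∧
      ∃ a : ℕ → E3 → F, (∀ n, ContDiff ℝ ∞ (a n)) ∧
        Tendsto (fun n => eLpNorm (fun x => a n x - u x) 2 (volume.restrict (ballR R)))
          atTop (𝓝 0) ∧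
        Tendsto (fun n => eLpNorm (fun x => fderiv ℝ (a n) x - u' x) 2
          (volume.restrict (ballR R))) atTop (𝓝 0) ∧
        Tendsto (fun n => eLpNorm (fun x => a n x - t x) 2 (surfaceMeasure R)) atTop (𝓝 0)

/-- The divergence of a vector field with Jacobian `J`. -/
def divOf (J : E3 → E3 →L[ℝ] E3) (x : E3) : ℝ := ∑ i : Fin 3, (J x (stdVec i)) i

/-- `‖∇θ‖²_{L²(B_R)}` for a vector field `θ` with Jacobian `J`. -/
def gradNormSq (R : ℝ) (J : E3 → E3 →L[ℝ] E3) : ℝ :=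
  ∫ x in ballR R, ∑ i : Fin 3, ∑ j : Fin 3, ((J x (stdVec i)) j) ^ 2

/-- A vector field with weak Jacobian `J` is irrotational on `B_R`: `∂ᵢθⱼ = ∂ⱼθᵢ` almost
everywhere, that is, its curl vanishes. -/
def Irrotational (R : ℝ) (J : E3 → E3 →L[ℝ] E3) : Prop :=
  ∀ᵐ x ∂(volume.restrict (ballR R)), ∀ i j : Fin 3, (J x (stdVec i)) j = (J x (stdVec j)) i

/-- `θ` belongs to `H = {θ ∈ H²(B_R) : (∇ · θ)|_{∂B_R} = 0}` and `J` is its weak Jacobian. -/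
def MemH (R : ℝ) (θ : E3 → E3) (J : E3 → E3 →L[ℝ] E3) : Prop :=
  MemLp θ 2 (volume.restrict (ballR R)) ∧
  HasWeakFDerivOn (ballR R) θ J ∧ MemLp J 2 (volume.restrict (ballR R)) ∧
  (∃ J' : E3 → E3 →L[ℝ] E3 →L[ℝ] E3,
    HasWeakFDerivOn (ballR R) J J' ∧ MemLp J' 2 (volume.restrict (ballR R))) ∧
  HasTrace R (divOf J) (fun _ => 0)

/-! ### The linearised operator -/

/-- The gravitational potential `𝒦 g (x) = - ∫_{B_R} g(y) / |x - y| dy`. -/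
def potential (R : ℝ) (g : E3 → ℝ) (x : E3) : ℝ :=
  - ∫ y in ballR R, g y / ‖x - y‖

/-- The boundary potential `∫_{∂B_R} t(z) / |x - z| · dS(z)`; the outward unit normal at `z` is
`z / R`. -/
def boundaryPotential (R : ℝ) (t : E3 → E3) (x : E3) : ℝ :=
  ∫ z, inner ℝ (t z) (R⁻¹ • z) / ‖x - z‖ ∂(surfaceMeasure R)

/-- `v ∈ L²(B_R)` is `𝐋θ`, where
`𝐋θ = -∇((γ ρ̄^(γ-2) + 𝒦) ∇·(ρ̄θ) + ∫_{∂B_R} θ(z) / |x - z| · dS(z))`.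
Here `M` is the weak Jacobian of `ρ̄θ`, `t` is the trace of `θ` on `∂B_R`, and the outer gradient is
taken in the weak sense; these determine `v` almost everywhere on `B_R`. -/
def IsLinearisedOp (γ R : ℝ) (f : ℝ → ℝ) (θ v : E3 → E3) : Prop :=
  MemLp v 2 (volume.restrict (ballR R)) ∧
  ∃ (M : E3 → E3 →L[ℝ] E3) (t : E3 → E3),
    HasWeakFDerivOn (ballR R) (fun x => density R f x • θ x) M ∧
    HasTrace R θ t ∧
    HasWeakFDerivOn (ballR R)
      (fun x => γ * density R f x ^ (γ - 2) * divOf M x + potential R (divOf M) x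
        + boundaryPotential R t x)
      (fun x => innerSL ℝ (-(v x)))

end LiquidStar

end

/-!
The energy `⟨𝐋θ, θ⟩` loses one derivative, relative to `‖∇θ‖²`, on gradients of harmonic functions
that concentrate near the boundary. Take `θₙ = (n + 1)⁻¹ ∇ Re (x₀ + i x₁)ⁿ⁺¹` (`harmonicField n`)
with `n` odd. These polynomial fields are divergence free and irrotational, and they are orthogonal
to the translations because they are odd and the density is even. Write `z = x₀ + i x₁`. Then
`|θₙ| = |z|ⁿ` and `‖∇θₙ‖² = 2 n² A`, where `A = ∫ |z|²ⁿ⁻²` over the ball (`planarMoment`).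

Since `∇·θₙ = 0`, the perturbation `∇·(ρ̄θₙ) = (f'(r) / r) Re zⁿ⁺¹` involves no derivative of `θₙ`.
The pressure part of `𝐋θₙ` is therefore a classical gradient of size `O(n |z|ⁿ)`
(`IsRegularProfile.norm_pressureGrad_le`), and it contributes `O(n A)` to the energy. The
gravitational and the boundary potential have densities of size `O(Rⁿ)`, and their gradients have
`L²` norm `O(Rⁿ)` as well, uniformly in `n` (`exists_integral_sq_potentialGrad_le`). As
`R²ⁿ = O(n³ A)` (`exists_planarMoment_ge`), the Cauchy–Schwarz inequality bounds their contribution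
by `O(Rⁿ A^(1/2)) = O(n^(3/2) A)`, which is `o(n² A)`.

For the potentials both measures, the volume of the ball and the area of the sphere, are treated as
finite measures `μ` with `∫ |x - y|^(-3/2) dμ(y)` bounded for `x` in the ball. By Fubini's theorem
and the weak derivative of `1 / |x|` (`integral_fderiv_mul_newtonKernel`), the potential of a
bounded density has the expected weak gradient (`hasWeakFDerivOn_potential`), and Schur's test gives
its `L²` bound. For the sphere, the condition on `μ` is
`exists_lintegral_surfaceMeasure_rieszKernel_le`.

Of the Lane–Emden profile only the regularity up to the boundary, the vanishing of `f'(0)`, and the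
bounds `1 ≤ f ≤ f(0)` enter (`IsRegularProfile`).
-/

open MeasureTheory Filter Topology
open scoped ContDiff

noncomputable section

namespace LiquidStar

/-! ### Weak derivatives of classically differentiable fields -/

section WeakDerivative

variable {F : Type*} [NormedAddCommGroup F] [NormedSpace ℝ F]

/-- A classical derivative on an open set is measurable there. -/
theorem aestronglyMeasurable_of_hasFDerivAt [FiniteDimensional ℝ F] {Ω : Set E3} (hΩ : IsOpen Ω)
    {u : E3 → F} {u' : E3 → E3 →L[ℝ] F} (h : ∀ x ∈ Ω, HasFDerivAt u (u' x) x) :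
    AEStronglyMeasurable u' (volume.restrict Ω) := by
  have : CompleteSpace F := FiniteDimensional.complete ℝ F
  have : ProperSpace (E3 →L[ℝ] F) := FiniteDimensional.proper ℝ _
  borelize (E3 →L[ℝ] F)
  refine ((measurable_fderiv ℝ u).aestronglyMeasurable).congr ?_
  filter_upwards [ae_restrict_mem hΩ.measurableSet] with x hx using (h x hx).fderiv

theorem aestronglyMeasurable_of_hasFDerivAt_self [FiniteDimensional ℝ F] {Ω : Set E3}
    (hΩ : IsOpen Ω) {u : E3 → F} {u' : E3 → E3 →L[ℝ] F} (h : ∀ x ∈ Ω, HasFDerivAt u (u' x) x) :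
    AEStronglyMeasurable u (volume.restrict Ω) :=
  ContinuousOn.aestronglyMeasurable (fun x hx => (h x hx).continuousAt.continuousWithinAt)
    hΩ.measurableSet

/-- The integral over `Ω` of a function supported in `Ω` is the integral over the whole space. -/
theorem setIntegral_eq_integral_of_support {G α : Type*} [NormedAddCommGroup G] [NormedSpace ℝ G]
    [MeasurableSpace α] {μ : Measure α} {Ω : Set α} {g : α → G} (h : Function.support g ⊆ Ω) :
    ∫ x in Ω, g x ∂μ = ∫ x, g x ∂μ :=
  setIntegral_eq_integral_of_forall_compl_eq_zero fun x hx => by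
    by_contra h0
    exact hx (h h0)

theorem continuous_fderiv_apply_of_smooth {φ : E3 → ℝ} (hφ : ContDiff ℝ ∞ φ) (e : E3) :
    Continuous fun x => fderiv ℝ φ x e :=
  (hφ.continuous_fderiv (by simp)).clm_apply continuous_const

theorem hasCompactSupport_fderiv_apply' {φ : E3 → ℝ} (hφ : HasCompactSupport φ) (e : E3) :
    HasCompactSupport fun x => fderiv ℝ φ x e :=
  (hφ.fderiv (𝕜 := ℝ)).comp_left (g := fun L : E3 →L[ℝ] ℝ => L e) (by simp)

theorem support_fderiv_apply_subset {φ : E3 → ℝ} (e : E3) :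
    Function.support (fun x => fderiv ℝ φ x e) ⊆ tsupport φ := fun x hx =>
  support_fderiv_subset ℝ (f := φ) (fun h => hx (by simp [h]))

/-- A field that is differentiable at every point of an open set of finite volume, bounded and with
bounded derivative, has that derivative as its weak derivative. Continuity of the derivative is not
needed. -/
theorem hasWeakFDerivOn_of_hasFDerivAt [FiniteDimensional ℝ F] {Ω : Set E3} (hΩ : IsOpen Ω)
    (hvol : volume Ω ≠ ⊤) {u : E3 → F} {u' : E3 → E3 →L[ℝ] F} {C : ℝ}
    (h : ∀ x ∈ Ω, HasFDerivAt u (u' x) x) (hu : ∀ x ∈ Ω, ‖u x‖ ≤ C)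
    (hu' : ∀ x ∈ Ω, ‖u' x‖ ≤ C) : HasWeakFDerivOn Ω u u' := by
  have hm := aestronglyMeasurable_of_hasFDerivAt_self hΩ h
  have hm' := aestronglyMeasurable_of_hasFDerivAt hΩ h
  have : IsFiniteMeasure (volume.restrict Ω) := ⟨by simpa using hvol.lt_top⟩
  have hi : IntegrableOn u Ω := Integrable.of_bound hm C (by
    filter_upwards [ae_restrict_mem hΩ.measurableSet] with x hx using hu x hx)
  have hi' : IntegrableOn u' Ω := Integrable.of_bound hm' C (by
    filter_upwards [ae_restrict_mem hΩ.measurableSet] with x hx using hu' x hx)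
  refine ⟨hi.locallyIntegrableOn, hi'.locallyIntegrableOn, fun φ hφ hc hs e => ?_⟩
  have hs0 : Function.support φ ⊆ Ω := (subset_tsupport φ).trans hs
  have hs1 : Function.support (fun x => fderiv ℝ φ x e) ⊆ Ω :=
    (support_fderiv_apply_subset e).trans hs
  have hcφ := hφ.continuous
  have hcφ' := continuous_fderiv_apply_of_smooth hφ e
  obtain ⟨A, hA⟩ := hc.exists_bound_of_continuous hcφ
  obtain ⟨B, hB⟩ := (hasCompactSupport_fderiv_apply' hc e).exists_bound_of_continuous hcφ'
  have s1 : Function.support (fun x => fderiv ℝ φ x e • u x) ⊆ Ω :=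
    (Function.support_smul_subset_left _ _).trans hs1
  have s2 : Function.support (fun x => φ x • u' x e) ⊆ Ω :=
    (Function.support_smul_subset_left _ _).trans hs0
  have s3 : Function.support (fun x => φ x • u x) ⊆ Ω :=
    (Function.support_smul_subset_left _ _).trans hs0
  have i1 : Integrable (fun x => fderiv ℝ φ x e • u x) :=
    (integrableOn_iff_integrable_of_support_subset s1).1
      (hi.bdd_smul B hcφ'.aestronglyMeasurable (Eventually.of_forall hB))
  have i2 : Integrable (fun x => φ x • u' x e) :=
    (integrableOn_iff_integrable_of_support_subset s2).1
      ((hi'.apply_continuousLinearMap e).bdd_smul A hcφ.aestronglyMeasurable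
        (Eventually.of_forall hA))
  have i3 : Integrable (fun x => φ x • u x) :=
    (integrableOn_iff_integrable_of_support_subset s3).1
      (hi.bdd_smul A hcφ.aestronglyMeasurable (Eventually.of_forall hA))
  rw [setIntegral_eq_integral_of_support s1, setIntegral_eq_integral_of_support s2]
  have key := integral_bilinear_hasFDerivAt_right_eq_neg_left_of_integrable
    (μ := (volume : Measure E3)) (f := φ) (f' := fderiv ℝ φ) (g := u) (g' := u') (v := e)
    (B := ContinuousLinearMap.lsmul ℝ ℝ) i1 i2 i3
    (fun x _ => ((hφ.differentiable (by simp)) x).hasFDerivAt) (fun x hx => h x (hs hx))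
  simp only [ContinuousLinearMap.lsmul_apply] at key
  rw [key, neg_neg]

theorem locallyIntegrableOn_add {G : Type*} [NormedAddCommGroup G] {Ω : Set E3} {g₁ g₂ : E3 → G}
    (h₁ : LocallyIntegrableOn g₁ Ω) (h₂ : LocallyIntegrableOn g₂ Ω) :
    LocallyIntegrableOn (fun x => g₁ x + g₂ x) Ω :=
  h₁.add h₂

theorem HasWeakFDerivOn.add {Ω : Set E3} {u w : E3 → F} {u' w' : E3 → E3 →L[ℝ] F}
    (hu : HasWeakFDerivOn Ω u u') (hw : HasWeakFDerivOn Ω w w') :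
    HasWeakFDerivOn Ω (fun x => u x + w x) (fun x => u' x + w' x) := by
  refine ⟨hu.1.add hw.1, locallyIntegrableOn_add hu.2.1 hw.2.1, fun φ hφ hc hs e => ?_⟩
  -- a locally integrable function times a continuous one supported in a compact part is integrable
  have aux : ∀ {g : E3 → F} {ψ : E3 → ℝ}, LocallyIntegrableOn g Ω → Continuous ψ →
      Function.support ψ ⊆ tsupport φ → IntegrableOn (fun x => ψ x • g x) Ω := by
    intro g ψ hg hψ hsub
    have hgi : IntegrableOn g (tsupport φ) := hg.integrableOn_compact_subset hs hc
    have : IntegrableOn (fun x => ψ x • g x) (tsupport φ) :=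
      hgi.continuousOn_smul hψ.continuousOn hc
    exact ((integrableOn_iff_integrable_of_support_subset
      ((Function.support_smul_subset_left _ _).trans hsub)).1 this).integrableOn
  have a1 := aux hu.1 (continuous_fderiv_apply_of_smooth hφ e) (support_fderiv_apply_subset e)
  have a2 := aux hw.1 (continuous_fderiv_apply_of_smooth hφ e) (support_fderiv_apply_subset e)
  have b : ∀ {g : E3 → E3 →L[ℝ] F}, LocallyIntegrableOn g Ω →
      IntegrableOn (fun x => φ x • g x e) Ω := by
    intro g hg
    have h1 : LocallyIntegrableOn (fun x => g x e) Ω := fun x hx => by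
      obtain ⟨s, hs, hi⟩ := hg x hx
      exact ⟨s, hs, hi.apply_continuousLinearMap e⟩
    exact aux h1 hφ.continuous (subset_tsupport φ)
  have b1 := b hu.2.1
  have b2 := b hw.2.1
  simp only [smul_add, add_apply]
  rw [integral_add a1 a2, integral_add b1 b2, hu.2.2 φ hφ hc hs e, hw.2.2 φ hφ hc hs e, neg_add]

end WeakDerivative

/-! ### The kernels `|x - y|⁻ᵃ` -/

section Kernel

/-- The kernel `|x - y|⁻ᵃ` with values in `[0, ∞]`. On the diagonal it takes the value `0` (for
`a ≠ 0`), which only makes upper bounds for integrals against it easier. -/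
def rieszKernel (a : ℝ) (x y : E3) : ENNReal := ENNReal.ofReal (‖x - y‖ ^ (-a))

theorem measurable_rieszKernel (a : ℝ) :
    Measurable fun p : E3 × E3 => rieszKernel a p.1 p.2 := by
  unfold rieszKernel
  fun_prop

theorem rieszKernel_mul {a b : ℝ} (hab : a + b ≠ 0) (x y : E3) :
    rieszKernel a x y * rieszKernel b x y = rieszKernel (a + b) x y := by
  unfold rieszKernel
  rw [← ENNReal.ofReal_mul (by positivity), ← Real.rpow_add' (norm_nonneg _)]
  · ring_nf
  · contrapose! hab; linarith

theorem lintegral_ball_norm_rpow_lt_top {a : ℝ} (ha : a < 3) :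
    ∫⁻ x in Metric.ball (0 : E3) 1, ENNReal.ofReal (‖x‖ ^ (-a)) < ⊤ := by
  have h : IntegrableOn (fun x : E3 => ‖x‖ ^ (-a)) (Metric.ball 0 1) := by
    rw [integrableOn_fun_norm_addHaar (volume : Measure E3) (f := fun r => r ^ (-a))]
    have h1 : IntegrableOn (fun y : ℝ => y ^ (2 - a)) (Set.Ioo 0 1) :=
      (intervalIntegral.integrableOn_Ioo_rpow_iff one_pos).2 (by linarith)
    refine h1.congr_fun (fun y hy => ?_) measurableSet_Ioo
    have : Module.finrank ℝ E3 - 1 = 2 := by simp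
    rw [this, smul_eq_mul, ← Real.rpow_natCast, ← Real.rpow_add hy.1]
    norm_num [sub_eq_add_neg]
  exact h.lintegral_lt_top

/-- For `a < 3` the kernel `|x - y|⁻ᵃ` is integrable in `x` over a ball, uniformly in `y`. -/
theorem exists_lintegral_rieszKernel_le {a : ℝ} (ha0 : 0 ≤ a) (ha : a < 3) (r : ℝ) :
    ∃ K : ENNReal, K ≠ ⊤ ∧ ∀ y : E3, ∫⁻ x in Metric.ball (0 : E3) r, rieszKernel a x y ≤ K := by
  refine ⟨(∫⁻ x in Metric.ball (0 : E3) 1, ENNReal.ofReal (‖x‖ ^ (-a))) +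
    volume (Metric.ball (0 : E3) r), ?_, fun y => ?_⟩
  · exact ENNReal.add_ne_top.2 ⟨(lintegral_ball_norm_rpow_lt_top ha).ne, (measure_ball_lt_top (μ := (volume : Measure E3))).ne⟩
  set g : E3 → ENNReal :=
    (Metric.ball (0 : E3) 1).indicator fun x => ENNReal.ofReal (‖x‖ ^ (-a)) with hg
  have hgm : Measurable g := Measurable.indicator (by fun_prop) measurableSet_ball
  have hpt : ∀ x, rieszKernel a x y ≤ g (x - y) + 1 := by
    intro x
    by_cases hx : x - y ∈ Metric.ball (0 : E3) 1
    · simp [hg, hx, rieszKernel]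
    · simp only [Metric.mem_ball, dist_zero_right, not_lt] at hx
      refine le_trans ?_ le_add_self
      unfold rieszKernel
      rw [ENNReal.ofReal_le_one]
      exact Real.rpow_le_one_of_one_le_of_nonpos hx (by linarith)
  calc ∫⁻ x in Metric.ball (0 : E3) r, rieszKernel a x y
      ≤ ∫⁻ x in Metric.ball (0 : E3) r, (g (x - y) + 1) := lintegral_mono hpt
    _ = (∫⁻ x in Metric.ball (0 : E3) r, g (x - y)) + volume (Metric.ball (0 : E3) r) := by
        rw [lintegral_add_right _ measurable_const]; simp
    _ ≤ (∫⁻ x, g (x - y)) + volume (Metric.ball (0 : E3) r) := by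
        gcongr; exact Measure.restrict_le_self
    _ = (∫⁻ x, g x) + volume (Metric.ball (0 : E3) r) := by
        rw [lintegral_sub_right_eq_self]
    _ = _ := by rw [hg, lintegral_indicator measurableSet_ball]

theorem lintegral_prod_rieszKernel_lt_top {a : ℝ} (ha0 : 0 ≤ a) (ha : a < 3) (r : ℝ)
    (μ : Measure E3) [IsFiniteMeasure μ] :
    ∫⁻ p, rieszKernel a p.1 p.2 ∂((volume.restrict (Metric.ball (0 : E3) r)).prod μ) < ⊤ := by
  obtain ⟨K, hK, h⟩ := exists_lintegral_rieszKernel_le ha0 ha r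
  rw [lintegral_prod_symm _ (measurable_rieszKernel a).aemeasurable]
  calc _ ≤ ∫⁻ _, K ∂μ := lintegral_mono fun y => h y
    _ = K * μ Set.univ := by simp
    _ < ⊤ := ENNReal.mul_lt_top hK.lt_top (measure_lt_top _ _)

theorem integrable_prod_norm_rpow {a : ℝ} (ha0 : 0 ≤ a) (ha : a < 3) (r : ℝ)
    (μ : Measure E3) [IsFiniteMeasure μ] :
    Integrable (fun p : E3 × E3 => ‖p.1 - p.2‖ ^ (-a))
      ((volume.restrict (Metric.ball (0 : E3) r)).prod μ) := by
  refine ⟨Measurable.aestronglyMeasurable (by fun_prop), ?_⟩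
  rw [hasFiniteIntegral_iff_ofReal (Eventually.of_forall fun p => by positivity)]
  exact lintegral_prod_rieszKernel_lt_top ha0 ha r μ

theorem integrableOn_norm_sub_rpow {a : ℝ} (ha0 : 0 ≤ a) (ha : a < 3) (r : ℝ) (y : E3) :
    IntegrableOn (fun x : E3 => ‖x - y‖ ^ (-a)) (Metric.ball 0 r) := by
  obtain ⟨K, hK, h⟩ := exists_lintegral_rieszKernel_le ha0 ha r
  refine ⟨Measurable.aestronglyMeasurable (by fun_prop), ?_⟩
  rw [hasFiniteIntegral_iff_ofReal (Eventually.of_forall fun p => by positivity)]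
  exact (h y).trans_lt hK.lt_top

theorem norm_inv_eq_rpow (d : E3) : ‖d‖⁻¹ = ‖d‖ ^ (-(1 : ℝ)) := by
  rw [Real.rpow_neg_one]

theorem norm_inv_cube_smul (d : E3) : ‖(‖d‖ ^ 3)⁻¹ • d‖ = ‖d‖ ^ (-(2 : ℝ)) := by
  rcases eq_or_ne d 0 with rfl | hd
  · simp
  · have : 0 < ‖d‖ := norm_pos_iff.2 hd
    rw [norm_smul, Real.norm_of_nonneg (by positivity), Real.rpow_neg this.le,
      Real.rpow_ofNat]
    field_simp

theorem hasFDerivAt_regularised (ε : ℝ) (hε : 0 < ε) (y x : E3) :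
    HasFDerivAt (fun x : E3 => (‖x - y‖ ^ 2 + ε) ^ (-(1 / 2) : ℝ))
      (-((‖x - y‖ ^ 2 + ε) ^ (-(3 / 2) : ℝ)) • innerSL ℝ (x - y)) x := by
  have h1 : HasFDerivAt (fun x : E3 => ‖x - y‖ ^ 2 + ε) (2 • innerSL ℝ (x - y)) x := by
    have := ((hasFDerivAt_id x).sub_const y).norm_sq.add_const ε
    simpa using this
  have h2 := h1.rpow_const (p := (-(1 / 2) : ℝ)) (Or.inl (by positivity))
  convert! h2 using 1
  ext e
  simp only [smul_apply, smul_eq_mul, nsmul_eq_mul]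
  norm_num
  ring

/-- The Newtonian kernel `1 / |x - y|` has the weak gradient `-(x - y) / |x - y|³`. The singularity
is removed by replacing `|x - y|²` by `|x - y|² + ε`, and `ε → 0` by dominated convergence. -/
theorem integral_fderiv_mul_newtonKernel (y e : E3) {φ : E3 → ℝ} (hφ : ContDiff ℝ ∞ φ)
    (hc : HasCompactSupport φ) :
    ∫ x, fderiv ℝ φ x e * ‖x - y‖⁻¹ = ∫ x, φ x * inner ℝ ((‖x - y‖ ^ 3)⁻¹ • (x - y)) e := by
  have hcφ := hφ.continuous
  have hcφ' := continuous_fderiv_apply_of_smooth hφ e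
  obtain ⟨A, hA⟩ := hc.exists_bound_of_continuous hcφ
  obtain ⟨B, hB⟩ := (hasCompactSupport_fderiv_apply' hc e).exists_bound_of_continuous hcφ'
  obtain ⟨r, hr⟩ := hc.isBounded.subset_ball (0 : E3)
  have hs0 : Function.support φ ⊆ Metric.ball 0 r := (subset_tsupport φ).trans hr
  have hs1 : Function.support (fun x => fderiv ℝ φ x e) ⊆ Metric.ball 0 r :=
    (support_fderiv_apply_subset e).trans hr
  set ε : ℕ → ℝ := fun n => 1 / ((n : ℝ) + 1) with hεdef
  have hε : ∀ n, 0 < ε n := fun n => by simp only [hεdef]; positivity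
  have hεlim : Tendsto ε atTop (𝓝 0) := tendsto_one_div_add_atTop_nhds_zero_nat
  have hcont : ∀ n (p : ℝ), Continuous fun x : E3 => (‖x - y‖ ^ 2 + ε n) ^ p := by
    intro n p
    have := hε n
    exact Continuous.rpow_const (by fun_prop) fun x => Or.inl (by positivity)
  have hparts : ∀ n, ∫ x in Metric.ball 0 r, fderiv ℝ φ x e * (‖x - y‖ ^ 2 + ε n) ^ (-(1 / 2) : ℝ)
      = ∫ x in Metric.ball 0 r,
        φ x * ((‖x - y‖ ^ 2 + ε n) ^ (-(3 / 2) : ℝ) * inner ℝ (x - y) e) := by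
    intro n
    rw [setIntegral_eq_integral_of_support
        ((Function.support_mul_subset_left _ _).trans hs1),
      setIntegral_eq_integral_of_support
        ((Function.support_mul_subset_left _ _).trans hs0)]
    have key := integral_bilinear_hasFDerivAt_right_eq_neg_left_of_integrable
      (μ := (volume : Measure E3)) (f := φ) (f' := fderiv ℝ φ)
      (g := fun x : E3 => (‖x - y‖ ^ 2 + ε n) ^ (-(1 / 2) : ℝ))
      (g' := fun x => -((‖x - y‖ ^ 2 + ε n) ^ (-(3 / 2) : ℝ)) • innerSL ℝ (x - y))
      (v := e) (B := ContinuousLinearMap.mul ℝ ℝ) ?_ ?_ ?_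
      (fun x _ => ((hφ.differentiable (by simp)) x).hasFDerivAt)
      (fun x _ => hasFDerivAt_regularised (ε n) (hε n) y x)
    · simp only [ContinuousLinearMap.mul_apply', smul_apply,
        innerSL_apply_apply, smul_eq_mul, neg_mul, mul_neg, integral_neg, neg_inj] at key
      exact key.symm
    · exact (hcφ'.mul (hcont n _)).integrable_of_hasCompactSupport
        ((hasCompactSupport_fderiv_apply' hc e).mul_right)
    · simp only [ContinuousLinearMap.mul_apply', smul_apply,
        innerSL_apply_apply, smul_eq_mul]
      refine Continuous.integrable_of_hasCompactSupport ?_ hc.mul_right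
      exact hcφ.mul ((hcont n _).neg.mul (by fun_prop))
    · exact (hcφ.mul (hcont n _)).integrable_of_hasCompactSupport hc.mul_right
  have hne : ∀ᵐ x ∂(volume.restrict (Metric.ball (0 : E3) r)), x ≠ y :=
    ae_restrict_of_ae (by simp [ae_iff])
  -- away from the singularity, powers of the regularised distance are dominated and converge
  have hdom : ∀ n x, x ≠ y → ∀ p : ℝ, 0 ≤ p →
      (‖x - y‖ ^ 2 + ε n) ^ (-p) ≤ (‖x - y‖ ^ 2) ^ (-p) := by
    intro n x hx p hp
    have : 0 < ‖x - y‖ := norm_pos_iff.2 (sub_ne_zero.2 hx)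
    exact Real.rpow_le_rpow_of_nonpos (by positivity) (by linarith [hε n]) (by linarith)
  have hlim : ∀ x, x ≠ y → ∀ p : ℝ,
      Tendsto (fun n => (‖x - y‖ ^ 2 + ε n) ^ p) atTop (𝓝 ((‖x - y‖ ^ 2) ^ p)) := by
    intro x hx p
    have : 0 < ‖x - y‖ := norm_pos_iff.2 (sub_ne_zero.2 hx)
    have h1 : Tendsto (fun n => ‖x - y‖ ^ 2 + ε n) atTop (𝓝 (‖x - y‖ ^ 2)) := by
      simpa using hεlim.const_add (‖x - y‖ ^ 2)
    exact h1.rpow_const (Or.inl (by positivity))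
  have hp1 : ∀ x, (‖x - y‖ ^ 2) ^ (-(1 / 2) : ℝ) = ‖x - y‖⁻¹ := by
    intro x
    rw [← Real.rpow_natCast, ← Real.rpow_mul (norm_nonneg _), norm_inv_eq_rpow]
    norm_num
  have hp3 : ∀ x, (‖x - y‖ ^ 2) ^ (-(3 / 2) : ℝ) = (‖x - y‖ ^ 3)⁻¹ := by
    intro x
    rw [← Real.rpow_natCast, ← Real.rpow_mul (norm_nonneg _), ← Real.rpow_natCast,
      ← Real.rpow_neg (norm_nonneg _)]
    norm_num
  have hL : Tendsto (fun n => ∫ x in Metric.ball 0 r,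
      fderiv ℝ φ x e * (‖x - y‖ ^ 2 + ε n) ^ (-(1 / 2) : ℝ)) atTop
      (𝓝 (∫ x in Metric.ball 0 r, fderiv ℝ φ x e * ‖x - y‖⁻¹)) := by
    refine tendsto_integral_of_dominated_convergence (fun x => B * ‖x - y‖ ^ (-(1 : ℝ)))
      (fun n => (hcφ'.mul (hcont n _)).aestronglyMeasurable)
      ((integrableOn_norm_sub_rpow zero_le_one (by norm_num) r y).const_mul B) (fun n => ?_) ?_
    · filter_upwards [hne] with x hx
      have := hε n
      rw [norm_mul, Real.norm_of_nonneg (show 0 ≤ (‖x - y‖ ^ 2 + ε n) ^ (-(1 / 2) : ℝ) by positivity),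
        ← norm_inv_eq_rpow, ← hp1]
      exact mul_le_mul (hB x) (hdom n x hx _ (by norm_num)) (by positivity)
        ((norm_nonneg _).trans (hB x))
    · filter_upwards [hne] with x hx
      rw [← hp1]
      exact (hlim x hx _).const_mul _
  have hR : Tendsto (fun n => ∫ x in Metric.ball 0 r,
      φ x * ((‖x - y‖ ^ 2 + ε n) ^ (-(3 / 2) : ℝ) * inner ℝ (x - y) e)) atTop
      (𝓝 (∫ x in Metric.ball 0 r, φ x * inner ℝ ((‖x - y‖ ^ 3)⁻¹ • (x - y)) e)) := by
    refine tendsto_integral_of_dominated_convergence (fun x => A * ‖e‖ * ‖x - y‖ ^ (-(2 : ℝ)))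
      (fun n => (hcφ.mul ((hcont n _).mul (by fun_prop))).aestronglyMeasurable)
      ((integrableOn_norm_sub_rpow zero_le_two (by norm_num) r y).const_mul _) (fun n => ?_) ?_
    · filter_upwards [hne] with x hx
      rw [norm_mul, mul_assoc A]
      refine mul_le_mul (hA x) ?_ (norm_nonneg _) ((norm_nonneg _).trans (hA x))
      rw [← norm_inv_cube_smul, norm_mul, norm_smul, ← hp3,
        Real.norm_of_nonneg (show 0 ≤ (‖x - y‖ ^ 2 + ε n) ^ (-(3 / 2) : ℝ) by
          have := hε n; positivity),
        Real.norm_of_nonneg (show 0 ≤ (‖x - y‖ ^ 2) ^ (-(3 / 2) : ℝ) by positivity)]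
      calc _ ≤ (‖x - y‖ ^ 2) ^ (-(3 / 2) : ℝ) * (‖x - y‖ * ‖e‖) :=
            mul_le_mul (hdom n x hx _ (by norm_num)) (norm_inner_le_norm _ _) (norm_nonneg _)
              (by positivity)
        _ = _ := by ring
    · filter_upwards [hne] with x hx
      rw [inner_smul_left, ← hp3]
      exact ((hlim x hx _).mul_const _).const_mul _
  rw [← setIntegral_eq_integral_of_support ((Function.support_mul_subset_left _ _).trans hs1),
    ← setIntegral_eq_integral_of_support ((Function.support_mul_subset_left _ _).trans hs0)]
  exact tendsto_nhds_unique hL (by simpa only [hparts] using hR)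

end Kernel

/-! ### Weak gradients of potentials of finite measures -/

section Potential

/-- The gradient `-∫ q(y) (x - y) / |x - y|³ dμ(y)` of the potential `∫ q(y) / |x - y| dμ(y)`. -/
def potentialGrad (μ : Measure E3) (q : E3 → ℝ) (x : E3) : E3 :=
  -∫ y, q y • ((‖x - y‖ ^ 3)⁻¹ • (x - y)) ∂μ

variable {R : ℝ} {μ : Measure E3} [IsFiniteMeasure μ] {q : E3 → ℝ} {Q : ℝ}

theorem integrable_prod_potential (hq : AEStronglyMeasurable q μ) (hQ : ∀ᵐ y ∂μ, |q y| ≤ Q) :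
    Integrable (fun p : E3 × E3 => q p.2 / ‖p.1 - p.2‖) ((volume.restrict (ballR R)).prod μ) := by
  simp only [div_eq_mul_inv, norm_inv_eq_rpow]
  refine (integrable_prod_norm_rpow zero_le_one (by norm_num) R μ).bdd_mul (c := Q)
    hq.comp_snd ?_
  exact Measure.quasiMeasurePreserving_snd.ae hQ

theorem integrable_prod_potentialGrad (hq : AEStronglyMeasurable q μ)
    (hQ : ∀ᵐ y ∂μ, |q y| ≤ Q) :
    Integrable (fun p : E3 × E3 => q p.2 • ((‖p.1 - p.2‖ ^ 3)⁻¹ • (p.1 - p.2)))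
      ((volume.restrict (ballR R)).prod μ) := by
  have h : Integrable (fun p : E3 × E3 => (‖p.1 - p.2‖ ^ 3)⁻¹ • (p.1 - p.2))
      ((volume.restrict (ballR R)).prod μ) := by
    refine (integrable_prod_norm_rpow zero_le_two (by norm_num) R μ).mono
      (Measurable.aestronglyMeasurable (by fun_prop)) (Eventually.of_forall fun p => ?_)
    rw [norm_inv_cube_smul]
    exact le_abs_self _
  exact h.bdd_smul Q hq.comp_snd (Measure.quasiMeasurePreserving_snd.ae hQ)

theorem aestronglyMeasurable_potentialGrad (hq : AEStronglyMeasurable q μ)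
    (hQ : ∀ᵐ y ∂μ, |q y| ≤ Q) :
    AEStronglyMeasurable (potentialGrad μ q) (volume.restrict (ballR R)) :=
  (integrable_prod_potentialGrad hq hQ).integral_prod_left.neg.aestronglyMeasurable

theorem locallyIntegrableOn_innerSL {G : E3 → E3} {Ω : Set E3} (h : IntegrableOn G Ω) :
    LocallyIntegrableOn (fun x => innerSL ℝ (G x)) Ω := by
  refine IntegrableOn.locallyIntegrableOn ?_
  refine Integrable.mono h ((innerSL ℝ).continuous.comp_aestronglyMeasurable
    h.aestronglyMeasurable) (Eventually.of_forall fun x => ?_)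
  rw [innerSL_apply_norm]

/-- The potential of a bounded density with respect to any finite measure on `ℝ³` is weakly
differentiable: test against `φ`, exchange the integrals, and use the weak derivative of the
kernel. -/
theorem hasWeakFDerivOn_potential (hq : AEStronglyMeasurable q μ) (hQ : ∀ᵐ y ∂μ, |q y| ≤ Q) :
    HasWeakFDerivOn (ballR R) (fun x => ∫ y, q y / ‖x - y‖ ∂μ)
      (fun x => innerSL ℝ (potentialGrad μ q x)) := by
  have I1 := integrable_prod_potential (R := R) hq hQ
  have I2 := integrable_prod_potentialGrad (R := R) hq hQ
  refine ⟨IntegrableOn.locallyIntegrableOn I1.integral_prod_left,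
    locallyIntegrableOn_innerSL I2.integral_prod_left.neg, fun φ hφ hc hs e => ?_⟩
  have hcφ := hφ.continuous
  have hcφ' := continuous_fderiv_apply_of_smooth hφ e
  obtain ⟨A, hA⟩ := hc.exists_bound_of_continuous hcφ
  obtain ⟨B, hB⟩ := (hasCompactSupport_fderiv_apply' hc e).exists_bound_of_continuous hcφ'
  have hs0 : Function.support φ ⊆ ballR R := (subset_tsupport φ).trans hs
  have hs1 : Function.support (fun x => fderiv ℝ φ x e) ⊆ ballR R :=
    (support_fderiv_apply_subset e).trans hs
  have J1 : Integrable (fun p : E3 × E3 => fderiv ℝ φ p.1 e * (q p.2 / ‖p.1 - p.2‖))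
      ((volume.restrict (ballR R)).prod μ) :=
    I1.bdd_mul (c := B) (hcφ'.comp continuous_fst).aestronglyMeasurable
      (Eventually.of_forall fun p => hB p.1)
  have J2 : Integrable (fun p : E3 × E3 => φ p.1 *
      inner ℝ (q p.2 • ((‖p.1 - p.2‖ ^ 3)⁻¹ • (p.1 - p.2))) e)
      ((volume.restrict (ballR R)).prod μ) :=
    (I2.inner_const e).bdd_mul (c := A) (hcφ.comp continuous_fst).aestronglyMeasurable
      (Eventually.of_forall fun p => hA p.1)
  calc ∫ x in ballR R, fderiv ℝ φ x e • ∫ y, q y / ‖x - y‖ ∂μ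
      = ∫ x in ballR R, ∫ y, fderiv ℝ φ x e * (q y / ‖x - y‖) ∂μ := by
        simp only [smul_eq_mul, integral_const_mul]
    _ = ∫ y, (∫ x in ballR R, fderiv ℝ φ x e * (q y / ‖x - y‖)) ∂μ := integral_integral_swap J1
    _ = ∫ y, (∫ x in ballR R,
          φ x * inner ℝ (q y • ((‖x - y‖ ^ 3)⁻¹ • (x - y))) e) ∂μ := by
        refine integral_congr_ae (Eventually.of_forall fun y => ?_)
        simp only
        rw [setIntegral_eq_integral_of_support ((Function.support_mul_subset_left _ _).trans hs1),
          setIntegral_eq_integral_of_support ((Function.support_mul_subset_left _ _).trans hs0)]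
        have := integral_fderiv_mul_newtonKernel y e hφ hc
        calc ∫ x, fderiv ℝ φ x e * (q y / ‖x - y‖)
            = ∫ x, q y * (fderiv ℝ φ x e * ‖x - y‖⁻¹) := by
              congr 1; ext x; rw [div_eq_mul_inv]; ring
          _ = ∫ x, q y * (φ x * inner ℝ ((‖x - y‖ ^ 3)⁻¹ • (x - y)) e) := by
              rw [integral_const_mul, this, integral_const_mul]
          _ = _ := by
              congr 1; ext x; rw [inner_smul_left _ _ (q y)]; simp only [conj_trivial]; ring
    _ = ∫ x in ballR R, ∫ y,
          φ x * inner ℝ (q y • ((‖x - y‖ ^ 3)⁻¹ • (x - y))) e ∂μ :=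
        (integral_integral_swap J2).symm
    _ = ∫ x in ballR R, -(φ x • innerSL ℝ (potentialGrad μ q x) e) := by
        refine integral_congr_ae ?_
        filter_upwards [I2.prod_right_ae] with x hx
        rw [integral_const_mul, innerSL_apply_apply, potentialGrad, inner_neg_left, smul_eq_mul,
          mul_neg, neg_neg]
        congr 1
        rw [real_inner_comm, ← integral_inner hx]
        simp only [real_inner_comm]
    _ = _ := integral_neg _

theorem measurable_rieszKernel_right (a : ℝ) (x : E3) : Measurable fun y => rieszKernel a x y := by
  unfold rieszKernel
  fun_prop

theorem lintegral_rieszKernel_two_sq_le (μ : Measure E3) (x : E3) :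
    (∫⁻ y, rieszKernel 2 x y ∂μ) ^ 2 ≤
      (∫⁻ y, rieszKernel (3 / 2) x y ∂μ) * ∫⁻ y, rieszKernel (5 / 2) x y ∂μ := by
  have h1 := ENNReal.lintegral_mul_le_Lp_mul_Lq μ (p := 2) (q := 2)
    (Real.holderConjugate_iff.2 ⟨by norm_num, by norm_num⟩)
    (measurable_rieszKernel_right (3 / 4) x).aemeasurable
    (measurable_rieszKernel_right (5 / 4) x).aemeasurable
  have e1 : ∀ y, rieszKernel (3 / 4) x y * rieszKernel (5 / 4) x y = rieszKernel 2 x y :=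
    fun y => by rw [rieszKernel_mul (by norm_num)]; norm_num
  have e2 : ∀ y, rieszKernel (3 / 4) x y ^ (2 : ℝ) = rieszKernel (3 / 2) x y := fun y => by
    rw [ENNReal.rpow_two, sq, rieszKernel_mul (by norm_num)]; norm_num
  have e3 : ∀ y, rieszKernel (5 / 4) x y ^ (2 : ℝ) = rieszKernel (5 / 2) x y := fun y => by
    rw [ENNReal.rpow_two, sq, rieszKernel_mul (by norm_num)]; norm_num
  simp only [Pi.mul_apply, e1, e2, e3] at h1
  calc (∫⁻ y, rieszKernel 2 x y ∂μ) ^ 2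
      ≤ ((∫⁻ y, rieszKernel (3 / 2) x y ∂μ) ^ (1 / 2 : ℝ) *
          (∫⁻ y, rieszKernel (5 / 2) x y ∂μ) ^ (1 / 2 : ℝ)) ^ 2 := by gcongr
    _ = _ := by
        rw [mul_pow, ← ENNReal.rpow_two, ← ENNReal.rpow_two, ← ENNReal.rpow_mul,
          ← ENNReal.rpow_mul]
        norm_num

theorem enorm_potentialGrad_le {μ : Measure E3} {q : E3 → ℝ} {Q : ℝ} (hQ : ∀ᵐ y ∂μ, |q y| ≤ Q) (x : E3) :
    ‖potentialGrad μ q x‖ₑ ≤ ENNReal.ofReal Q * ∫⁻ y, rieszKernel 2 x y ∂μ := by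
  rw [potentialGrad, enorm_neg, ← lintegral_const_mul _ (measurable_rieszKernel_right 2 x)]
  refine (enorm_integral_le_lintegral_enorm _).trans (lintegral_mono_ae ?_)
  filter_upwards [hQ] with y hy
  rw [← ofReal_norm, norm_smul, norm_inv_cube_smul, ENNReal.ofReal_mul (norm_nonneg _)]
  exact mul_le_mul_left (ENNReal.ofReal_le_ofReal hy) _

theorem lintegral_enorm_sq_potentialGrad_le {C : ENNReal} (hC : C ≠ ⊤)
    (h : ∀ x ∈ ballR R, ∫⁻ y, rieszKernel (3 / 2) x y ∂μ ≤ C) (hQ : ∀ᵐ y ∂μ, |q y| ≤ Q) :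
    ∫⁻ x in ballR R, ‖potentialGrad μ q x‖ₑ ^ 2 ≤ ENNReal.ofReal Q ^ 2 * (C *
      ∫⁻ p, rieszKernel (5 / 2) p.1 p.2 ∂((volume.restrict (ballR R)).prod μ)) := by
  calc ∫⁻ x in ballR R, ‖potentialGrad μ q x‖ₑ ^ 2
      ≤ ∫⁻ x in ballR R, ENNReal.ofReal Q ^ 2 * (C * ∫⁻ y, rieszKernel (5 / 2) x y ∂μ) := by
        refine setLIntegral_mono' Metric.isOpen_ball.measurableSet fun x hx => ?_
        calc ‖potentialGrad μ q x‖ₑ ^ 2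
            ≤ (ENNReal.ofReal Q * ∫⁻ y, rieszKernel 2 x y ∂μ) ^ 2 :=
              pow_le_pow_left' (enorm_potentialGrad_le hQ x) 2
          _ = ENNReal.ofReal Q ^ 2 * (∫⁻ y, rieszKernel 2 x y ∂μ) ^ 2 := mul_pow _ _ _
          _ ≤ ENNReal.ofReal Q ^ 2 * (C * ∫⁻ y, rieszKernel (5 / 2) x y ∂μ) := by
              refine mul_le_mul_right ((lintegral_rieszKernel_two_sq_le μ x).trans ?_) _
              exact mul_le_mul_left (h x hx) _
    _ = _ := by
        rw [lintegral_const_mul' _ _ (by simp), lintegral_const_mul' _ _ hC,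
          lintegral_prod _ (measurable_rieszKernel _).aemeasurable]

/-- If the potential of `μ` with the kernel `|x - y|^(-3/2)` is bounded on the ball, then the
gradient of the Newtonian potential of a density bounded by `Q` has `L²` norm `O(Q)`. This is
Schur's test: `|x - y|⁻² = |x - y|^(-3/4) |x - y|^(-5/4)`, where the square of the first factor is
`μ`-integrable in `y`, and that of the second is Lebesgue integrable in `x`. -/
theorem exists_integral_sq_potentialGrad_le (μ : Measure E3) [IsFiniteMeasure μ] {C : ENNReal}
    (hC : C ≠ ⊤) (h : ∀ x ∈ ballR R, ∫⁻ y, rieszKernel (3 / 2) x y ∂μ ≤ C) :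
    ∃ K : ℝ, 0 ≤ K ∧ ∀ (q : E3 → ℝ) (Q : ℝ), 0 ≤ Q → AEStronglyMeasurable q μ →
      (∀ᵐ y ∂μ, |q y| ≤ Q) →
      MemLp (potentialGrad μ q) 2 (volume.restrict (ballR R)) ∧
      ∫ x in ballR R, ‖potentialGrad μ q x‖ ^ 2 ≤ K * Q ^ 2 := by
  obtain ⟨S, hS⟩ : ∃ S, S = C *
    ∫⁻ p, rieszKernel (5 / 2) p.1 p.2 ∂((volume.restrict (ballR R)).prod μ) := ⟨_, rfl⟩
  have hSfin : S < ⊤ := hS ▸ ENNReal.mul_lt_top hC.lt_top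
    (lintegral_prod_rieszKernel_lt_top (by norm_num) (by norm_num) R μ)
  refine ⟨S.toReal, ENNReal.toReal_nonneg, fun q Q hQ0 hq hQ => ?_⟩
  have hmeas := aestronglyMeasurable_potentialGrad (R := R) hq hQ
  have hL := lintegral_enorm_sq_potentialGrad_le hC h hQ
  rw [← hS] at hL
  have hfin : ENNReal.ofReal Q ^ 2 * S < ⊤ := ENNReal.mul_lt_top (by simp) hSfin
  refine ⟨⟨hmeas, ?_⟩, ?_⟩
  · rw [eLpNorm_lt_top_iff_lintegral_rpow_enorm_lt_top (by simp) (by simp)]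
    simpa using hL.trans_lt hfin
  · rw [integral_eq_lintegral_of_nonneg_ae (Eventually.of_forall fun x => by positivity)
      (hmeas.norm.aemeasurable.pow_const 2).aestronglyMeasurable]
    refine ENNReal.toReal_le_of_le_ofReal (by positivity) ?_
    rw [mul_comm, ENNReal.ofReal_mul (by positivity), ENNReal.ofReal_pow hQ0,
      ENNReal.ofReal_toReal hSfin.ne]
    simpa only [ENNReal.ofReal_pow (norm_nonneg _), ofReal_norm] using hL

end Potential

/-! ### The volume and the surface measure of the ball -/

section Measures

theorem rieszKernel_comm (a : ℝ) (x y : E3) : rieszKernel a x y = rieszKernel a y x := by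
  unfold rieszKernel
  rw [norm_sub_rev]

instance isFiniteMeasure_volume_ballR (R : ℝ) :
    IsFiniteMeasure ((volume : Measure E3).restrict (ballR R)) :=
  ⟨by simpa [ballR] using measure_ball_lt_top (μ := (volume : Measure E3)) (x := 0) (r := R)⟩

instance isFiniteMeasure_surfaceMeasure (R : ℝ) : IsFiniteMeasure (surfaceMeasure R) := by
  unfold surfaceMeasure
  exact Measure.smul_finite _ ENNReal.ofReal_ne_top

theorem ae_surfaceMeasure {R : ℝ} (hR : 0 < R) : ∀ᵐ z ∂(surfaceMeasure R), ‖z‖ = R := by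
  unfold surfaceMeasure
  refine Measure.ae_smul_measure ?_ _
  rw [ae_map_iff (Measurable.aemeasurable (by fun_prop))
    (measurableSet_eq_fun (by fun_prop) (by fun_prop))]
  exact Eventually.of_forall fun s => by
    rw [norm_smul, norm_eq_of_mem_sphere, mul_one, Real.norm_of_nonneg hR.le]

theorem exists_lintegral_ballR_rieszKernel_le {a : ℝ} (ha0 : 0 ≤ a) (ha : a < 3) (R : ℝ) :
    ∃ C : ENNReal, C ≠ ⊤ ∧ ∀ x ∈ ballR R,
      ∫⁻ y, rieszKernel a x y ∂((volume : Measure E3).restrict (ballR R)) ≤ C := by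
  obtain ⟨K, hK, h⟩ := exists_lintegral_rieszKernel_le ha0 ha R
  refine ⟨K, hK, fun x _ => ?_⟩
  simp only [rieszKernel_comm a x]
  exact h x

theorem ofReal_le_volumeIoiPow_Ico {δ : ℝ} (hδ : 0 ≤ δ) :
    ENNReal.ofReal δ ≤ Measure.volumeIoiPow 2
      {t : Set.Ioi (0 : ℝ) | 1 ≤ (t : ℝ) ∧ (t : ℝ) < 1 + δ} := by
  have h1 := Measure.volumeIoiPow_apply_Iio 2 ⟨1, by simp⟩
  have h2 := Measure.volumeIoiPow_apply_Iio 2 ⟨1 + δ, by simp; linarith⟩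
  have hsub : Set.Iio (⟨1 + δ, by simp; linarith⟩ : Set.Ioi (0 : ℝ)) ⊆ Set.Iio ⟨1, by simp⟩ ∪
      {t : Set.Ioi (0 : ℝ) | 1 ≤ (t : ℝ) ∧ (t : ℝ) < 1 + δ} := by
    intro t ht
    rcases lt_or_ge (t : ℝ) 1 with h | h
    · exact Or.inl h
    · exact Or.inr ⟨h, ht⟩
  have h3 := (measure_mono hsub).trans (measure_union_le (μ := Measure.volumeIoiPow 2) _ _)
  rw [h1, h2] at h3
  simp only at h3
  have h4 : ENNReal.ofReal ((1 : ℝ) ^ (2 + 1) / ((2 : ℕ) + 1)) + ENNReal.ofReal δ ≤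
      ENNReal.ofReal ((1 + δ) ^ (2 + 1) / ((2 : ℕ) + 1)) := by
    rw [← ENNReal.ofReal_add (by positivity) hδ]
    refine ENNReal.ofReal_le_ofReal ?_
    push_cast
    nlinarith [pow_nonneg hδ 2, pow_nonneg hδ 3]
  exact (ENNReal.add_le_add_iff_left ENNReal.ofReal_ne_top).1 (h4.trans h3)

/-- Moving outward along the ray through a point `R s` of the sphere, the kernel with exponent
`5/2` stays comparable to its value at `R s` for a length comparable to `|x - R s|`. Hence its
integral along the ray dominates the kernel with exponent `3/2` at `R s`. -/
theorem rieszKernel_sphere_le_lintegral_ray {R : ℝ} (hR : 0 < R) {x : E3} (hx : x ∈ ballR R)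
    (s : Metric.sphere (0 : E3) 1) :
    ENNReal.ofReal ((2 * R)⁻¹ * (3 / 2) ^ (-(5 / 2) : ℝ)) * rieszKernel (3 / 2) x (R • (s : E3)) ≤
      ∫⁻ t, (Set.Iio (⟨2, by simp⟩ : Set.Ioi (0 : ℝ))).indicator
        (fun t : Set.Ioi (0 : ℝ) => rieszKernel (5 / 2) x (R • ((t : ℝ) • (s : E3)))) t
        ∂(Measure.volumeIoiPow 2) := by
  have hx' : ‖x‖ < R := by simpa [ballR] using hx
  have hs : ‖(s : E3)‖ = 1 := norm_eq_of_mem_sphere s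
  have hRs : ‖R • (s : E3)‖ = R := by rw [norm_smul, hs, mul_one, Real.norm_of_nonneg hR.le]
  set d := ‖x - R • (s : E3)‖ with hd
  have hd0 : 0 < d := by
    have := norm_sub_norm_le (R • (s : E3)) x
    rw [norm_sub_rev, ← hd] at this
    linarith
  have hd2 : d < 2 * R := by
    have := norm_sub_le x (R • (s : E3))
    rw [← hd] at this
    linarith
  set δ := d / (2 * R) with hδ
  have hδ0 : 0 < δ := by positivity
  have hδ1 : δ < 1 := (div_lt_one (by positivity)).2 hd2
  set T : Set (Set.Ioi (0 : ℝ)) := {t | 1 ≤ (t : ℝ) ∧ (t : ℝ) < 1 + δ} with hT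
  have hTm : MeasurableSet T := by
    apply MeasurableSet.inter
    · exact measurableSet_le measurable_const measurable_subtype_coe
    · exact measurableSet_lt measurable_subtype_coe measurable_const
  have hlow : ∀ t ∈ T, ENNReal.ofReal ((3 / 2 * d) ^ (-(5 / 2) : ℝ)) ≤
      (Set.Iio (⟨2, by simp⟩ : Set.Ioi (0 : ℝ))).indicator
        (fun t : Set.Ioi (0 : ℝ) => rieszKernel (5 / 2) x (R • ((t : ℝ) • (s : E3)))) t := by
    rintro t ⟨ht1, ht2⟩
    have htI : t ∈ Set.Iio (⟨2, by simp⟩ : Set.Ioi (0 : ℝ)) := by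
      change (t : ℝ) < 2
      linarith
    rw [Set.indicator_of_mem htI, rieszKernel]
    refine ENNReal.ofReal_le_ofReal (Real.rpow_le_rpow_of_nonpos ?_ ?_ (by norm_num))
    · have h1 := norm_sub_norm_le (R • ((t : ℝ) • (s : E3))) x
      rw [norm_sub_rev, norm_smul, norm_smul, hs, Real.norm_of_nonneg hR.le,
        Real.norm_of_nonneg (by linarith : (0 : ℝ) ≤ t)] at h1
      nlinarith
    · have h1 : x - R • ((t : ℝ) • (s : E3)) = (x - R • (s : E3)) - ((t : ℝ) - 1) • R • (s : E3) := by
        module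
      rw [h1]
      refine (norm_sub_le _ _).trans ?_
      rw [norm_smul _ (R • (s : E3)), hRs, Real.norm_of_nonneg (by linarith), ← hd]
      have : δ * R = d / 2 := by rw [hδ]; field_simp
      nlinarith
  calc _ = ENNReal.ofReal ((3 / 2 * d) ^ (-(5 / 2) : ℝ)) * ENNReal.ofReal δ := by
        rw [rieszKernel, ← hd, ← ENNReal.ofReal_mul (by positivity),
          ← ENNReal.ofReal_mul (by positivity)]
        congr 1
        rw [Real.mul_rpow (by norm_num) hd0.le, hδ]
        have : d ^ (-(3 / 2) : ℝ) = d ^ (-(5 / 2) : ℝ) * d := by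
          rw [← Real.rpow_add_one hd0.ne']; norm_num
        rw [this]
        field_simp
    _ ≤ ENNReal.ofReal ((3 / 2 * d) ^ (-(5 / 2) : ℝ)) * Measure.volumeIoiPow 2 T := by
        gcongr
        exact ofReal_le_volumeIoiPow_Ico hδ0.le
    _ = ∫⁻ t in T, ENNReal.ofReal ((3 / 2 * d) ^ (-(5 / 2) : ℝ)) ∂(Measure.volumeIoiPow 2) := by
        rw [setLIntegral_const]
    _ ≤ _ := (setLIntegral_mono' hTm hlow).trans (setLIntegral_le_lintegral _ _)

/-- Integration in polar coordinates over the ball of radius `2`, as an inequality. -/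
theorem lintegral_sphere_ray_le {g : E3 → ENNReal} (hg : Measurable g) :
    ∫⁻ s, (∫⁻ t, (Set.Iio (⟨2, by simp⟩ : Set.Ioi (0 : ℝ))).indicator
        (fun t : Set.Ioi (0 : ℝ) => g ((t : ℝ) • (s : E3))) t ∂(Measure.volumeIoiPow 2))
        ∂(Measure.toSphere (volume : Measure E3)) ≤
      ∫⁻ y in Metric.ball (0 : E3) 2, g y := by
  set F : Metric.sphere (0 : E3) 1 × Set.Ioi (0 : ℝ) → ENNReal := fun p =>
    (Prod.snd ⁻¹' Set.Iio (⟨2, by simp⟩ : Set.Ioi (0 : ℝ))).indicator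
      (fun p : Metric.sphere (0 : E3) 1 × Set.Ioi (0 : ℝ) => g ((p.2 : ℝ) • (p.1 : E3))) p with hF
  have hFm : Measurable F :=
    Measurable.indicator (hg.comp (by fun_prop)) (measurable_snd measurableSet_Iio)
  have hmp := Measure.measurePreserving_homeomorphUnitSphereProd (volume : Measure E3)
  have hdim : Module.finrank ℝ E3 - 1 = 2 := by simp
  rw [hdim] at hmp
  calc _ = ∫⁻ s, (∫⁻ t, F (s, t) ∂(Measure.volumeIoiPow 2))
        ∂(Measure.toSphere (volume : Measure E3)) := rfl
    _ = ∫⁻ p, F p ∂((Measure.toSphere (volume : Measure E3)).prod (Measure.volumeIoiPow 2)) :=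
        (lintegral_prod _ hFm.aemeasurable).symm
    _ = ∫⁻ y, F (homeomorphUnitSphereProd E3 y) ∂((volume : Measure E3).comap (↑)) :=
        (hmp.lintegral_comp hFm).symm
    _ = ∫⁻ y : ({0}ᶜ : Set E3), (Metric.ball (0 : E3) 2).indicator g (y : E3)
          ∂((volume : Measure E3).comap (↑)) := by
        refine lintegral_congr fun y => ?_
        have hy : (y : E3) ≠ 0 := y.2
        have h2 : (((homeomorphUnitSphereProd E3 y).2 : Set.Ioi (0 : ℝ)) : ℝ) = ‖(y : E3)‖ := by simp
        have h1 : (((homeomorphUnitSphereProd E3 y).1 : Metric.sphere (0 : E3) 1) : E3) =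
            ‖(y : E3)‖⁻¹ • (y : E3) := by simp
        have hmem : ((homeomorphUnitSphereProd E3 y) ∈
            Prod.snd ⁻¹' Set.Iio (⟨2, by simp⟩ : Set.Ioi (0 : ℝ))) ↔
            (y : E3) ∈ Metric.ball (0 : E3) 2 := by
          rw [mem_ball_zero_iff, ← h2]; rfl
        by_cases hb : (y : E3) ∈ Metric.ball (0 : E3) 2
        · simp only [hF]
          rw [Set.indicator_of_mem (hmem.2 hb), Set.indicator_of_mem hb, h1, h2, smul_smul,
            mul_inv_cancel₀ (norm_ne_zero_iff.2 hy), one_smul]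
        · simp only [hF]
          rw [Set.indicator_of_notMem (mt hmem.1 hb), Set.indicator_of_notMem hb]
    _ = ∫⁻ y in ({0}ᶜ : Set E3), (Metric.ball (0 : E3) 2).indicator g y :=
        lintegral_subtype_comap (measurableSet_singleton _).compl _
    _ ≤ ∫⁻ y, (Metric.ball (0 : E3) 2).indicator g y := setLIntegral_le_lintegral _ _
    _ = _ := lintegral_indicator measurableSet_ball _

/-- The potential of the surface measure with the kernel `|x - z|^(-3/2)` is bounded on the ball:
integrating `rieszKernel_sphere_le_lintegral_ray` over the sphere bounds it by a volume integral of
the kernel with exponent `5/2 < 3`. -/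
theorem exists_lintegral_surfaceMeasure_rieszKernel_le {R : ℝ} (hR : 0 < R) :
    ∃ C : ENNReal, C ≠ ⊤ ∧ ∀ x ∈ ballR R,
      ∫⁻ y, rieszKernel (3 / 2) x y ∂(surfaceMeasure R) ≤ C := by
  obtain ⟨K, hK, hKb⟩ := exists_lintegral_rieszKernel_le (a := 5 / 2) (by norm_num) (by norm_num) 2
  set κ := ENNReal.ofReal ((2 * R)⁻¹ * (3 / 2) ^ (-(5 / 2) : ℝ)) with hκ
  have hκ0 : κ ≠ 0 := by
    rw [hκ, Ne, ENNReal.ofReal_eq_zero, not_le]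
    positivity
  refine ⟨ENNReal.ofReal (R ^ 2) * (κ⁻¹ * (ENNReal.ofReal (R ^ (-(5 / 2) : ℝ)) * K)), ?_,
    fun x hx => ?_⟩
  · exact ENNReal.mul_ne_top ENNReal.ofReal_ne_top (ENNReal.mul_ne_top (ENNReal.inv_ne_top.2 hκ0)
      (ENNReal.mul_ne_top ENNReal.ofReal_ne_top hK))
  rw [surfaceMeasure, lintegral_smul_measure, smul_eq_mul,
    lintegral_map (measurable_rieszKernel_right _ x) (by fun_prop)]
  refine mul_le_mul_right ?_ _
  rw [← ENNReal.mul_le_iff_le_inv hκ0 ENNReal.ofReal_ne_top, ← lintegral_const_mul' _ _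
    ENNReal.ofReal_ne_top]
  have hscale : ∀ y : E3, rieszKernel (5 / 2) x (R • y) =
      ENNReal.ofReal (R ^ (-(5 / 2) : ℝ)) * rieszKernel (5 / 2) y (R⁻¹ • x) := by
    intro y
    rw [rieszKernel_comm _ y, rieszKernel, rieszKernel, ← ENNReal.ofReal_mul (by positivity),
      ← Real.mul_rpow hR.le (norm_nonneg _)]
    congr 2
    rw [← Real.norm_of_nonneg hR.le, ← norm_smul, Real.norm_of_nonneg hR.le, smul_sub, smul_smul,
      mul_inv_cancel₀ hR.ne', one_smul]
  calc _ ≤ ∫⁻ s, _ ∂(Measure.toSphere (volume : Measure E3)) :=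
        lintegral_mono fun s => rieszKernel_sphere_le_lintegral_ray hR hx s
    _ ≤ ∫⁻ y in Metric.ball (0 : E3) 2, rieszKernel (5 / 2) x (R • y) :=
        lintegral_sphere_ray_le ((measurable_rieszKernel_right _ x).comp (by fun_prop))
    _ = ENNReal.ofReal (R ^ (-(5 / 2) : ℝ)) *
          ∫⁻ y in Metric.ball (0 : E3) 2, rieszKernel (5 / 2) y (R⁻¹ • x) := by
        simp only [hscale]
        rw [lintegral_const_mul' _ _ ENNReal.ofReal_ne_top]
    _ ≤ _ := mul_le_mul_right (hKb _) _

end Measures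

/-! ### Fields that are smooth up to the boundary -/

section Smooth

variable {F : Type*} [NormedAddCommGroup F] [NormedSpace ℝ F] [FiniteDimensional ℝ F]

theorem exists_norm_le_on_closedBall {G : Type*} [NormedAddCommGroup G] {u : E3 → G}
    (hu : Continuous u) (R : ℝ) : ∃ C : ℝ, ∀ x, ‖x‖ ≤ R → ‖u x‖ ≤ C := by
  obtain ⟨C, hC⟩ := (isCompact_closedBall (0 : E3) R).exists_bound_of_continuousOn hu.continuousOn
  exact ⟨C, fun x hx => hC x (by simpa using hx)⟩

theorem norm_le_of_mem_ballR {R : ℝ} {x : E3} (hx : x ∈ ballR R) : ‖x‖ ≤ R := by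
  have : ‖x‖ < R := by simpa [ballR] using hx
  exact this.le

theorem memLp_ballR_of_continuous {G : Type*} [NormedAddCommGroup G] {u : E3 → G}
    (hu : Continuous u) (R : ℝ) : MemLp u 2 (volume.restrict (ballR R)) := by
  obtain ⟨C, hC⟩ := exists_norm_le_on_closedBall hu R
  refine MemLp.of_bound hu.aestronglyMeasurable C ?_
  filter_upwards [ae_restrict_mem Metric.isOpen_ball.measurableSet] with x hx
    using hC x (norm_le_of_mem_ballR hx)

theorem memLp_surfaceMeasure_of_continuous {G : Type*} [NormedAddCommGroup G] {u : E3 → G}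
    (hu : Continuous u) {R : ℝ} (hR : 0 < R) : MemLp u 2 (surfaceMeasure R) := by
  obtain ⟨C, hC⟩ := exists_norm_le_on_closedBall hu R
  refine MemLp.of_bound hu.aestronglyMeasurable C ?_
  filter_upwards [ae_surfaceMeasure hR] with x hx using hC x hx.le

theorem hasWeakFDerivOn_fderiv_of_contDiff {u : E3 → F} (hu : ContDiff ℝ ∞ u) (R : ℝ) :
    HasWeakFDerivOn (ballR R) u (fderiv ℝ u) := by
  obtain ⟨C, hC⟩ := exists_norm_le_on_closedBall hu.continuous R
  obtain ⟨C', hC'⟩ := exists_norm_le_on_closedBall (hu.continuous_fderiv (by simp)) R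
  exact hasWeakFDerivOn_of_hasFDerivAt (C := max C C') Metric.isOpen_ball
    (measure_ball_lt_top (μ := (volume : Measure E3))).ne
    (fun x _ => (hu.differentiable (by simp) x).hasFDerivAt)
    (fun x hx => (hC x (norm_le_of_mem_ballR hx)).trans (le_max_left _ _))
    (fun x hx => (hC' x (norm_le_of_mem_ballR hx)).trans (le_max_right _ _))

theorem tendsto_eLpNorm_sub_self {G : Type*} [NormedAddCommGroup G] (g : E3 → G)
    (μ : Measure E3) :
    Tendsto (fun _ : ℕ => eLpNorm (fun x => g x - g x) 2 μ) atTop (𝓝 0) := by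
  simp

theorem hasTrace_of_contDiff {u : E3 → F} (hu : ContDiff ℝ ∞ u) {R : ℝ} (hR : 0 < R) :
    HasTrace R u u :=
  ⟨memLp_ballR_of_continuous hu.continuous R, memLp_surfaceMeasure_of_continuous hu.continuous hR,
    fderiv ℝ u, hasWeakFDerivOn_fderiv_of_contDiff hu R,
    memLp_ballR_of_continuous (hu.continuous_fderiv (by simp)) R, fun _ => u, fun _ => hu,
    tendsto_eLpNorm_sub_self u _, tendsto_eLpNorm_sub_self (fderiv ℝ u) _,
    tendsto_eLpNorm_sub_self u _⟩

end Smooth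

/-! ### Planar harmonic fields -/

section Harmonic

/-- The complex coordinate `x₀ + i x₁` of a point of `ℝ³`. -/
def planar : E3 →L[ℝ] ℂ :=
  (EuclideanSpace.proj 0 : E3 →L[ℝ] ℝ).smulRight (1 : ℂ) +
    (EuclideanSpace.proj 1 : E3 →L[ℝ] ℝ).smulRight Complex.I

/-- The horizontal vector `(Re w, -Im w, 0)`. It is the gradient of `Re g` at a point with
complex coordinate `z` when `g` is holomorphic with `g' z = w`. -/
def conjVec : ℂ →L[ℝ] E3 :=
  Complex.reCLM.smulRight (stdVec 0) - Complex.imCLM.smulRight (stdVec 1)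

theorem planar_apply (x : E3) : planar x = x 0 + x 1 * Complex.I := by
  simp [planar]

theorem conjVec_apply_zero (w : ℂ) : conjVec w 0 = w.re := by simp [conjVec, stdVec]

theorem conjVec_apply_one (w : ℂ) : conjVec w 1 = -w.im := by simp [conjVec, stdVec]

theorem conjVec_apply_two (w : ℂ) : conjVec w 2 = 0 := by simp [conjVec, stdVec]

theorem planar_stdVec_zero : planar (stdVec 0) = 1 := by simp [planar_apply, stdVec]

theorem planar_stdVec_one : planar (stdVec 1) = Complex.I := by simp [planar_apply, stdVec]

theorem planar_stdVec_two : planar (stdVec 2) = 0 := by simp [planar_apply, stdVec]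

theorem inner_conjVec (x : E3) (w : ℂ) : inner ℝ x (conjVec w) = (planar x * w).re := by
  rw [PiLp.inner_apply, Fin.sum_univ_three, conjVec_apply_zero, conjVec_apply_one,
    conjVec_apply_two, planar_apply]
  simp
  ring

theorem inner_stdVec_left (i : Fin 3) (x : E3) : inner ℝ (stdVec i) x = x i := by
  rw [stdVec, EuclideanSpace.inner_single_left]
  simp

theorem norm_conjVec (w : ℂ) : ‖conjVec w‖ = ‖w‖ := by
  have h : ‖conjVec w‖ ^ 2 = ‖w‖ ^ 2 := by
    rw [EuclideanSpace.real_norm_sq_eq, Fin.sum_univ_three, conjVec_apply_zero, conjVec_apply_one,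
      conjVec_apply_two, Complex.sq_norm, Complex.normSq_apply]
    ring
  exact (sq_eq_sq₀ (norm_nonneg _) (norm_nonneg _)).1 h

theorem norm_planar_le (x : E3) : ‖planar x‖ ≤ ‖x‖ := by
  refine (sq_le_sq₀ (norm_nonneg _) (norm_nonneg _)).1 ?_
  rw [EuclideanSpace.real_norm_sq_eq, Fin.sum_univ_three, Complex.sq_norm, Complex.normSq_apply,
    planar_apply]
  simp
  nlinarith [sq_nonneg (x 2)]

/-- The harmonic polynomial `Re (x₀ + i x₁)ⁿ⁺¹`. -/
def harmonicPoly (n : ℕ) (x : E3) : ℝ := (planar x ^ (n + 1)).re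

/-- The field `(n + 1)⁻¹ ∇ Re (x₀ + i x₁)ⁿ⁺¹`. -/
def harmonicField (n : ℕ) (x : E3) : E3 := conjVec (planar x ^ n)

/-- The Jacobian of `harmonicField n`. -/
def harmonicJac (n : ℕ) (x : E3) : E3 →L[ℝ] E3 :=
  conjVec.comp (((n : ℂ) * planar x ^ (n - 1)) • planar)

theorem contDiff_harmonicField (n : ℕ) : ContDiff ℝ ∞ (harmonicField n) :=
  conjVec.contDiff.comp (planar.contDiff.pow n)

theorem hasFDerivAt_planar_pow (n : ℕ) (x : E3) :
    HasFDerivAt (fun x => planar x ^ n) (((n : ℂ) * planar x ^ (n - 1)) • planar) x := by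
  have h := (planar.hasFDerivAt (x := x)).pow n
  convert! h using 1
  ext e
  simp [mul_assoc]

theorem hasFDerivAt_harmonicField (n : ℕ) (x : E3) :
    HasFDerivAt (harmonicField n) (harmonicJac n x) x :=
  conjVec.hasFDerivAt.comp x (hasFDerivAt_planar_pow n x)

theorem fderiv_harmonicField (n : ℕ) : fderiv ℝ (harmonicField n) = harmonicJac n :=
  funext fun x => (hasFDerivAt_harmonicField n x).fderiv

theorem hasFDerivAt_harmonicPoly (n : ℕ) (x : E3) :
    HasFDerivAt (harmonicPoly n) (innerSL ℝ (((n : ℝ) + 1) • harmonicField n x)) x := by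
  have h := (Complex.reCLM.hasFDerivAt).comp x (hasFDerivAt_planar_pow (n + 1) x)
  convert! h using 1
  ext e
  rw [innerSL_apply_apply, inner_smul_left, real_inner_comm, harmonicField, inner_conjVec]
  simp [mul_comm, mul_left_comm]

theorem inner_self_harmonicField (n : ℕ) (x : E3) :
    inner ℝ x (harmonicField n x) = harmonicPoly n x := by
  rw [harmonicField, inner_conjVec, harmonicPoly, pow_succ']

theorem norm_harmonicField (n : ℕ) (x : E3) : ‖harmonicField n x‖ = ‖planar x‖ ^ n := by
  rw [harmonicField, norm_conjVec, norm_pow]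

theorem abs_harmonicPoly_le (n : ℕ) (x : E3) : |harmonicPoly n x| ≤ ‖planar x‖ ^ (n + 1) := by
  rw [harmonicPoly, ← norm_pow]
  exact Complex.abs_re_le_norm _

theorem harmonicJac_apply (n : ℕ) (x : E3) (i j : Fin 3) :
    harmonicJac n x (stdVec i) j =
      (planar (stdVec j) * ((n : ℂ) * planar x ^ (n - 1) * planar (stdVec i))).re := by
  rw [← inner_stdVec_left, harmonicJac, ContinuousLinearMap.comp_apply, inner_conjVec]
  rfl

theorem divOf_harmonicJac (n : ℕ) (x : E3) : divOf (harmonicJac n) x = 0 := by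
  simp only [divOf, harmonicJac_apply, Fin.sum_univ_three, planar_stdVec_zero, planar_stdVec_one,
    planar_stdVec_two]
  simp

theorem irrotational_harmonicJac (R : ℝ) (n : ℕ) : Irrotational R (harmonicJac n) :=
  Eventually.of_forall fun x i j => by
    rw [harmonicJac_apply, harmonicJac_apply]
    congr 1
    ring

/-- `∫ |z|²ⁿ⁻²` over the ball, where `z = x₀ + i x₁`; up to the factor `2 n²` this is
`‖∇θ‖²` for the field `harmonicField n`. -/
def planarMoment (R : ℝ) (n : ℕ) : ℝ := ∫ x in ballR R, ‖planar x‖ ^ (2 * n - 2)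

theorem gradNormSq_harmonicJac (R : ℝ) (n : ℕ) :
    gradNormSq R (harmonicJac n) = 2 * (n : ℝ) ^ 2 * planarMoment R n := by
  rw [gradNormSq, planarMoment, ← integral_const_mul]
  refine integral_congr_ae (Eventually.of_forall fun x => ?_)
  have h : ∀ w : ℂ, ‖(n : ℂ) * w‖ ^ 2 = (n : ℝ) ^ 2 * ‖w‖ ^ 2 := fun w => by
    rw [norm_mul, mul_pow]; simp
  have h2 : ‖planar x‖ ^ (2 * n - 2) = ‖planar x ^ (n - 1)‖ ^ 2 := by
    rw [norm_pow, ← pow_mul]; congr 1; omega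
  simp only [harmonicJac_apply, Fin.sum_univ_three, planar_stdVec_zero, planar_stdVec_one,
    planar_stdVec_two]
  rw [h2, mul_assoc 2, ← h, Complex.sq_norm, Complex.normSq_apply]
  simp
  ring

theorem harmonicField_neg {n : ℕ} (hn : Odd n) (x : E3) :
    harmonicField n (-x) = -harmonicField n x := by
  rw [harmonicField, map_neg, hn.neg_pow, map_neg, harmonicField]

/-- An odd field is orthogonal to the constant fields, as the weight is even. -/
theorem weightedInner_harmonicField_const (R : ℝ) (f : ℝ → ℝ) {n : ℕ} (hn : Odd n) (a : E3) :
    weightedInner R f (harmonicField n) (fun _ => a) = 0 := by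
  have hb : MeasurableSet (ballR R) := Metric.isOpen_ball.measurableSet
  rw [weightedInner, ← integral_indicator hb]
  set g := (ballR R).indicator fun x => density R f x * inner ℝ (harmonicField n x) a with hg
  have h : ∀ x, g (-x) = -g x := by
    intro x
    have hmem : -x ∈ ballR R ↔ x ∈ ballR R := by simp [ballR]
    have hd : density R f (-x) = density R f x := by
      classical simp [density, Set.indicator_apply]
    by_cases hx : x ∈ ballR R
    · rw [hg, Set.indicator_of_mem (hmem.2 hx), Set.indicator_of_mem hx, hd, harmonicField_neg hn,
        inner_neg_left, mul_neg]
    · rw [hg, Set.indicator_of_notMem (mt hmem.1 hx), Set.indicator_of_notMem hx, neg_zero]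
  have h2 : ∫ x, g x = ∫ x, -g x := by
    rw [← integral_neg_eq_self g volume]
    simp only [h]
  rw [integral_neg] at h2
  linarith

theorem memH_harmonicField {R : ℝ} (hR : 0 < R) (n : ℕ) :
    MemH R (harmonicField n) (harmonicJac n) := by
  have hθ := contDiff_harmonicField n
  have hJ : ContDiff ℝ ∞ (harmonicJac n) := by
    rw [← fderiv_harmonicField]
    exact hθ.fderiv_right (by simp)
  refine ⟨memLp_ballR_of_continuous hθ.continuous R, ?_,
    memLp_ballR_of_continuous hJ.continuous R, ⟨fderiv ℝ (harmonicJac n),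
      hasWeakFDerivOn_fderiv_of_contDiff hJ R,
      memLp_ballR_of_continuous (hJ.continuous_fderiv (by simp)) R⟩, ?_⟩
  · rw [← fderiv_harmonicField]
    exact hasWeakFDerivOn_fderiv_of_contDiff hθ R
  · rw [show divOf (harmonicJac n) = fun _ => 0 from funext (divOf_harmonicJac n)]
    exact hasTrace_of_contDiff contDiff_const hR

/-- A lower bound for `planarMoment`, from a ball of radius `R / (8 n)` that touches the sphere at
the equator. On it `|z| ≥ R (1 - 1 / (4 n))`. -/
theorem exists_planarMoment_ge {R : ℝ} (hR : 0 < R) :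
    ∃ α : ℝ, 0 < α ∧ ∀ n : ℕ, n ≠ 0 → α * R ^ (2 * n) ≤ (n : ℝ) ^ 3 * planarMoment R n := by
  set κ := (volume : Measure E3).real (Metric.ball 0 1) with hκ
  have hκ0 : 0 < κ := ENNReal.toReal_pos (Metric.measure_ball_pos _ _ one_pos).ne'
    measure_ball_lt_top.ne
  refine ⟨κ * R / 1024, by positivity, fun n hn => ?_⟩
  have hn1 : (1 : ℝ) ≤ n := by exact_mod_cast Nat.one_le_iff_ne_zero.2 hn
  set ε : ℝ := R / (8 * n) with hε
  have hε0 : 0 < ε := by positivity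
  have hεR : 8 * ε * n = R := by rw [hε]; field_simp
  set c : E3 := (R - ε) • stdVec 0 with hc
  have hRε : 0 ≤ R - ε := by nlinarith
  have hnc : ‖c‖ = R - ε := by
    rw [hc, norm_smul, Real.norm_of_nonneg hRε]; simp [stdVec]
  have hpc : ‖planar c‖ = R - ε := by
    rw [hc, map_smul, planar_stdVec_zero, norm_smul, Real.norm_of_nonneg hRε]; simp
  have hsub : Metric.ball c ε ⊆ ballR R := by
    intro x hx
    rw [Metric.mem_ball, dist_eq_norm] at hx
    have := norm_le_norm_add_norm_sub' x c
    rw [ballR, mem_ball_zero_iff]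
    linarith
  have hlow : ∀ x ∈ Metric.ball c ε, R ^ (2 * n - 2) / 2 ≤ ‖planar x‖ ^ (2 * n - 2) := by
    intro x hx
    rw [Metric.mem_ball, dist_eq_norm] at hx
    have h1 : R - 2 * ε ≤ ‖planar x‖ := by
      have h2 := norm_planar_le (x - c)
      have h3 := norm_le_norm_add_norm_sub' (planar c) (planar x)
      rw [norm_sub_rev, ← map_sub] at h3
      linarith
    have h4 : R - 2 * ε = R * (1 + (-(1 / (4 * (n : ℝ))))) := by rw [hε]; field_simp; ring
    have h5 : (1 : ℝ) / 2 ≤ (1 + (-(1 / (4 * (n : ℝ))))) ^ (2 * n - 2) := by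
      have hle : 1 / (4 * (n : ℝ)) ≤ 1 := by
        rw [div_le_one (by positivity)]; linarith
      refine le_trans ?_ (one_add_mul_le_pow (by linarith) (2 * n - 2))
      have h6 : ((2 * n - 2 : ℕ) : ℝ) ≤ 2 * n := by
        exact_mod_cast Nat.sub_le _ _
      have h7 : 2 * (n : ℝ) * (1 / (4 * (n : ℝ))) = 1 / 2 := by field_simp; norm_num
      nlinarith [show 0 < 1 / (4 * (n : ℝ)) by positivity]
    calc R ^ (2 * n - 2) / 2 = R ^ (2 * n - 2) * (1 / 2) := by ring
      _ ≤ R ^ (2 * n - 2) * (1 + (-(1 / (4 * (n : ℝ))))) ^ (2 * n - 2) := by gcongr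
      _ = (R - 2 * ε) ^ (2 * n - 2) := by rw [h4, mul_pow]
      _ ≤ _ := pow_le_pow_left₀ (by nlinarith) h1 _
  have hcont : Continuous fun x : E3 => ‖planar x‖ ^ (2 * n - 2) := by fun_prop
  have hint : IntegrableOn (fun x : E3 => ‖planar x‖ ^ (2 * n - 2)) (ballR R) :=
    (hcont.continuousOn.integrableOn_compact (isCompact_closedBall (0 : E3) R)).mono_set
      Metric.ball_subset_closedBall
  have hvol : (volume : Measure E3).real (Metric.ball c ε) = ε ^ 3 * κ := by
    rw [measureReal_def, Measure.addHaar_ball _ _ hε0.le]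
    simp [hκ, measureReal_def, ENNReal.toReal_mul, hε0.le]
  have hA : R ^ (2 * n - 2) / 2 * (ε ^ 3 * κ) ≤ planarMoment R n := by
    calc R ^ (2 * n - 2) / 2 * (ε ^ 3 * κ)
        = ∫ _ in Metric.ball c ε, R ^ (2 * n - 2) / 2 := by
          rw [setIntegral_const, hvol, smul_eq_mul, mul_comm]
      _ ≤ ∫ x in Metric.ball c ε, ‖planar x‖ ^ (2 * n - 2) :=
          setIntegral_mono_on (integrableOn_const measure_ball_lt_top.ne) (hint.mono_set hsub)
            measurableSet_ball hlow
      _ ≤ _ := setIntegral_mono_set hint (Eventually.of_forall fun x => by positivity)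
          hsub.eventuallyLE
  have hpow : R ^ (2 * n) = R ^ (2 * n - 2) * R ^ 2 := by
    rw [← pow_add]; congr 1; omega
  calc κ * R / 1024 * R ^ (2 * n) = (n : ℝ) ^ 3 * (R ^ (2 * n - 2) / 2 * (ε ^ 3 * κ)) := by
        rw [hpow, hε]; field_simp; norm_num
    _ ≤ _ := by gcongr

end Harmonic

/-! ### The density profile -/

section Profile

variable {γ R : ℝ} {f : ℝ → ℝ}

/-- The regularity of a density profile that the argument uses: `f₁` and `f₂` are its first two
derivatives on `[0, R]`, and `|f₁ r| ≤ C r`, so that `f₁ r / r` is bounded near the centre. -/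
structure IsRegularProfile (R C : ℝ) (f f₁ f₂ : ℝ → ℝ) : Prop where
  nonneg : 0 ≤ C
  hasDerivAt : ∀ r ∈ Set.Ioo 0 R, HasDerivAt f (f₁ r) r
  hasDerivAt₁ : ∀ r ∈ Set.Ioo 0 R, HasDerivAt f₁ (f₂ r) r
  hasDerivWithinAt_zero : HasDerivWithinAt f 0 (Set.Icc 0 R) 0
  continuousOn₁ : ContinuousOn f₁ (Set.Icc 0 R)
  abs_le₁ : ∀ r ∈ Set.Icc 0 R, |f₁ r| ≤ C * r
  abs_le₂ : ∀ r ∈ Set.Icc 0 R, |f₂ r| ≤ C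
  one_le : ∀ r ∈ Set.Icc 0 R, 1 ≤ f r
  le_zero : ∀ r ∈ Set.Icc 0 R, f r ≤ f 0

theorem IsLaneEmdenProfile.exists_isRegularProfile (hf : IsLaneEmdenProfile γ R f) :
    ∃ (C : ℝ) (f₁ f₂ : ℝ → ℝ), IsRegularProfile R C f f₁ f₂ := by
  have hR := hf.radius_pos
  have hu : UniqueDiffOn ℝ (Set.Icc 0 R) := uniqueDiffOn_Icc hR
  have h0 : (0 : ℝ) ∈ Set.Icc 0 R := ⟨le_rfl, hR.le⟩
  have hRR : R ∈ Set.Icc 0 R := ⟨hR.le, le_rfl⟩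
  set f₁ := derivWithin f (Set.Icc 0 R) with hf₁
  set f₂ := derivWithin f₁ (Set.Icc 0 R) with hf₂
  have hC1 : ContDiffOn ℝ 1 f₁ (Set.Icc 0 R) := hf.contDiffOn.derivWithin hu (by norm_num)
  have hC0 : ContinuousOn f₂ (Set.Icc 0 R) := hC1.continuousOn_derivWithin hu le_rfl
  have hd : ∀ r ∈ Set.Icc 0 R, HasDerivWithinAt f (f₁ r) (Set.Icc 0 R) r := fun r hr =>
    (hf.contDiffOn.differentiableOn (by norm_num) r hr).hasDerivWithinAt
  have hd1 : ∀ r ∈ Set.Icc 0 R, HasDerivWithinAt f₁ (f₂ r) (Set.Icc 0 R) r := fun r hr =>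
    (hC1.differentiableOn (by norm_num) r hr).hasDerivWithinAt
  obtain ⟨C, hC⟩ := isCompact_Icc.exists_bound_of_continuousOn hC0
  have hnhds : ∀ r ∈ Set.Ioo 0 R, Set.Icc 0 R ∈ 𝓝 r := fun r hr => Icc_mem_nhds hr.1 hr.2
  refine ⟨C, f₁, f₂, (norm_nonneg _).trans (hC 0 h0), ?_, ?_, ?_, hC1.continuousOn, ?_, hC, ?_, ?_⟩
  · exact fun r hr => (hd r (Set.Ioo_subset_Icc_self hr)).hasDerivAt (hnhds r hr)
  · exact fun r hr => (hd1 r (Set.Ioo_subset_Icc_self hr)).hasDerivAt (hnhds r hr)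
  · have := hd 0 h0
    rwa [hf₁, hf.deriv_zero] at this
  · intro r hr
    have h := (convex_Icc 0 R).norm_image_sub_le_of_norm_hasDerivWithin_le hd1 hC h0 hr
    rw [hf₁, hf.deriv_zero, sub_zero, sub_zero, Real.norm_of_nonneg hr.1] at h
    exact h
  · intro r hr
    rw [← hf.boundary_value]
    exact hf.strictAntiOn.antitoneOn hr hRR hr.2
  · exact fun r hr => hf.strictAntiOn.antitoneOn h0 hr hr.1

variable {C : ℝ} {f₁ f₂ : ℝ → ℝ}

/-- The radial factor `γ f^(γ-2) f' / r` of the pressure term. -/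
def pressureCoeff (γ : ℝ) (f f₁ : ℝ → ℝ) (r : ℝ) : ℝ := γ * f r ^ (γ - 2) * (f₁ r / r)

/-- The derivative of `pressureCoeff`. -/
def pressureCoeffDeriv (γ : ℝ) (f f₁ f₂ : ℝ → ℝ) (r : ℝ) : ℝ :=
  γ * ((γ - 2) * f r ^ (γ - 3) * f₁ r * (f₁ r / r) +
    f r ^ (γ - 2) * (f₂ r / r - f₁ r / r ^ 2))

theorem IsRegularProfile.abs_div_le (hp : IsRegularProfile R C f f₁ f₂) {r : ℝ}
    (hr : r ∈ Set.Icc 0 R) : |f₁ r / r| ≤ C := by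
  rcases hr.1.eq_or_lt with h | h
  · rw [← h]; simpa using hp.nonneg
  · rw [abs_div, abs_of_pos h, div_le_iff₀ h]
    exact hp.abs_le₁ r hr

theorem IsRegularProfile.rpow_mem (hp : IsRegularProfile R C f f₁ f₂) {r p : ℝ}
    (hr : r ∈ Set.Icc 0 R) (h : p ≤ 0) : 0 ≤ f r ^ p ∧ f r ^ p ≤ 1 :=
  ⟨Real.rpow_nonneg (zero_le_one.trans (hp.one_le r hr)) _,
    Real.rpow_le_one_of_one_le_of_nonpos (hp.one_le r hr) h⟩

theorem IsRegularProfile.abs_pressureCoeff_le (hp : IsRegularProfile R C f f₁ f₂)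
    (hγ : 1 ≤ γ) (hγ' : γ ≤ 2) {r : ℝ} (hr : r ∈ Set.Icc 0 R) :
    |pressureCoeff γ f f₁ r| ≤ 2 * C := by
  obtain ⟨h1, h2⟩ := hp.rpow_mem hr (show γ - 2 ≤ 0 by linarith)
  rw [pressureCoeff, abs_mul, abs_mul, abs_of_nonneg h1, abs_of_nonneg (by linarith : 0 ≤ γ)]
  calc γ * f r ^ (γ - 2) * |f₁ r / r| ≤ 2 * 1 * C := by
        gcongr
        exact hp.abs_div_le hr
    _ = 2 * C := by ring

theorem IsRegularProfile.hasDerivAt_pressureCoeff (hp : IsRegularProfile R C f f₁ f₂) {r : ℝ}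
    (hr : r ∈ Set.Ioo 0 R) :
    HasDerivAt (pressureCoeff γ f f₁) (pressureCoeffDeriv γ f f₁ f₂ r) r := by
  have hf0 : f r ≠ 0 := by linarith [hp.one_le r (Set.Ioo_subset_Icc_self hr)]
  have h1 := ((hp.hasDerivAt r hr).rpow_const (p := γ - 2) (Or.inl hf0)).const_mul γ
  have h2 := (hp.hasDerivAt₁ r hr).div (hasDerivAt_id r) hr.1.ne'
  have h3 := h1.mul h2
  refine h3.congr_deriv ?_
  have hr0 : r ≠ 0 := hr.1.ne'
  have : γ - 2 - 1 = γ - 3 := by ring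
  rw [pressureCoeffDeriv, this]
  simp only [id, Pi.div_apply]
  field_simp

theorem IsRegularProfile.abs_pressureCoeffDeriv_mul_le (hp : IsRegularProfile R C f f₁ f₂)
    (hγ : 1 ≤ γ) (hγ' : γ ≤ 2) {r : ℝ} (hr : r ∈ Set.Ioo 0 R) :
    |pressureCoeffDeriv γ f f₁ f₂ r| * r ≤ 2 * (C ^ 2 * R ^ 2 + 2 * C) := by
  have hI := Set.Ioo_subset_Icc_self hr
  have hr0 : 0 < r := hr.1
  have hC := hp.nonneg
  obtain ⟨h1, h2⟩ := hp.rpow_mem hI (show γ - 2 ≤ 0 by linarith)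
  obtain ⟨h3, h4⟩ := hp.rpow_mem hI (show γ - 3 ≤ 0 by linarith)
  have e : pressureCoeffDeriv γ f f₁ f₂ r * r =
      γ * ((γ - 2) * f r ^ (γ - 3) * (f₁ r * f₁ r) + f r ^ (γ - 2) * (f₂ r - f₁ r / r)) := by
    rw [pressureCoeffDeriv]
    field_simp
  have hf1 : |f₁ r| ≤ C * R := (hp.abs_le₁ r hI).trans (by gcongr; exact hr.2.le)
  have b1 : |(γ - 2) * f r ^ (γ - 3) * (f₁ r * f₁ r)| ≤ 1 * 1 * ((C * R) * (C * R)) := by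
    rw [abs_mul, abs_mul, abs_mul, abs_of_nonneg h3]
    gcongr
    · rw [abs_le]; constructor <;> linarith
    · exact mul_nonneg hC (hr0.trans hr.2).le
  have b2 : |f r ^ (γ - 2) * (f₂ r - f₁ r / r)| ≤ 1 * (C + C) := by
    rw [abs_mul, abs_of_nonneg h1]
    gcongr
    exact (abs_sub _ _).trans (add_le_add (hp.abs_le₂ r hI) (hp.abs_div_le hI))
  calc |pressureCoeffDeriv γ f f₁ f₂ r| * r = |pressureCoeffDeriv γ f f₁ f₂ r * r| := by
        rw [abs_mul, abs_of_pos hr0]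
    _ = γ * |(γ - 2) * f r ^ (γ - 3) * (f₁ r * f₁ r) + f r ^ (γ - 2) * (f₂ r - f₁ r / r)| := by
        rw [e, abs_mul, abs_of_nonneg (by linarith : 0 ≤ γ)]
    _ ≤ 2 * (1 * 1 * ((C * R) * (C * R)) + 1 * (C + C)) := by
        gcongr
        exact (abs_add_le _ _).trans (add_le_add b1 b2)
    _ = _ := by ring

end Profile

/-! ### Radial multiples of the harmonic fields -/

section Radial

variable {γ R C : ℝ} {f f₁ f₂ : ℝ → ℝ}

theorem density_of_mem (f : ℝ → ℝ) {x : E3} (hx : x ∈ ballR R) : density R f x = f ‖x‖ :=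
  Set.indicator_of_mem (Metric.ball_subset_closedBall hx) _

theorem norm_mem_Icc {x : E3} (hx : x ∈ ballR R) : ‖x‖ ∈ Set.Icc 0 R :=
  ⟨norm_nonneg _, norm_le_of_mem_ballR hx⟩

theorem norm_mem_Ioo {x : E3} (hx : x ∈ ballR R) (h0 : x ≠ 0) : ‖x‖ ∈ Set.Ioo 0 R :=
  ⟨norm_pos_iff.2 h0, by simpa [ballR] using hx⟩

theorem ballR_mem_nhds {x : E3} (hx : x ∈ ballR R) : ballR R ∈ 𝓝 x :=
  Metric.isOpen_ball.mem_nhds hx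

theorem hasFDerivAt_radial {g : ℝ → ℝ} {g' : ℝ} {x : E3} (h0 : x ≠ 0)
    (h : HasDerivAt g g' ‖x‖) :
    HasFDerivAt (fun y : E3 => g ‖y‖) (innerSL ℝ ((g' / ‖x‖) • x)) x := by
  have hn : HasFDerivAt (fun y : E3 => ‖y‖) (innerSL ℝ (‖x‖⁻¹ • x)) x := by
    have h1 := (hasFDerivAt_id x).norm_sq.sqrt (by simpa using h0)
    simp only [id, Real.sqrt_sq (norm_nonneg _)] at h1
    convert! h1 using 1
    ext e
    simp
    field_simp
  have h2 := h.comp_hasFDerivAt x hn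
  convert! h2 using 1
  ext e
  simp
  ring

theorem IsRegularProfile.hasFDerivAt_norm (hp : IsRegularProfile R C f f₁ f₂) {x : E3}
    (hx : x ∈ ballR R) :
    HasFDerivAt (fun y : E3 => f ‖y‖) (innerSL ℝ ((f₁ ‖x‖ / ‖x‖) • x)) x := by
  rcases eq_or_ne x 0 with rfl | h0
  · have h1 := hasDerivWithinAt_iff_isLittleO.1 hp.hasDerivWithinAt_zero
    have ht : Tendsto (fun y : E3 => ‖y‖) (𝓝 0) (𝓝[Set.Icc 0 R] 0) := by
      refine tendsto_nhdsWithin_iff.2 ⟨by simpa using (continuous_norm (E := E3)).tendsto 0, ?_⟩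
      filter_upwards [ballR_mem_nhds hx] with y hy using norm_mem_Icc hy
    have h2 := h1.comp_tendsto ht
    refine HasFDerivAt.of_isLittleO ?_
    rw [← Asymptotics.isLittleO_norm_right]
    simpa [Function.comp_def] using h2
  · exact hasFDerivAt_radial h0 (hp.hasDerivAt _ (norm_mem_Ioo hx h0))

/-- The gradient of `pressureCoeff · harmonicPoly`. -/
def pressureGrad (γ : ℝ) (f f₁ f₂ : ℝ → ℝ) (n : ℕ) (x : E3) : E3 :=
  (harmonicPoly n x * (pressureCoeffDeriv γ f f₁ f₂ ‖x‖ / ‖x‖)) • x +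
    pressureCoeff γ f f₁ ‖x‖ • (((n : ℝ) + 1) • harmonicField n x)

theorem abs_harmonicPoly_le_norm_mul (n : ℕ) (x : E3) :
    |harmonicPoly n x| ≤ ‖x‖ * ‖planar x‖ ^ n := by
  refine (abs_harmonicPoly_le n x).trans ?_
  rw [pow_succ']
  gcongr
  exact norm_planar_le x

theorem IsRegularProfile.hasFDerivAt_pressure (hp : IsRegularProfile R C f f₁ f₂)
    (hγ : 1 ≤ γ) (hγ' : γ ≤ 2) {n : ℕ} (hn : n ≠ 0) {x : E3} (hx : x ∈ ballR R) :
    HasFDerivAt (fun y => pressureCoeff γ f f₁ ‖y‖ * harmonicPoly n y)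
      (innerSL ℝ (pressureGrad γ f f₁ f₂ n x)) x := by
  rcases eq_or_ne x 0 with rfl | h0
  · -- at the centre the bounded coefficient multiplies a polynomial of order at least two
    have hG : pressureGrad γ f f₁ f₂ n 0 = 0 := by
      simp [pressureGrad, harmonicField, hn]
    have hP := (hasFDerivAt_harmonicPoly n 0).isLittleO
    have hP0 : harmonicPoly n 0 = 0 := by simp [harmonicPoly]
    have hF0 : harmonicField n 0 = 0 := by simp [harmonicField, hn]
    refine HasFDerivAt.of_isLittleO ?_
    rw [hG]
    simp only [hP0, hF0, smul_zero, map_zero, zero_apply, sub_zero, mul_zero] at hP ⊢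
    refine Asymptotics.IsBigO.trans_isLittleO ?_ hP
    refine Asymptotics.IsBigO.of_bound (2 * C) ?_
    filter_upwards [ballR_mem_nhds hx] with y hy
    rw [norm_mul]
    gcongr
    exact hp.abs_pressureCoeff_le hγ hγ' (norm_mem_Icc hy)
  · have h1 := hasFDerivAt_radial h0
      (hp.hasDerivAt_pressureCoeff (γ := γ) (norm_mem_Ioo hx h0))
    have h2 := h1.mul (hasFDerivAt_harmonicPoly n x)
    convert! h2 using 1
    ext e
    simp [pressureGrad]
    ring

theorem IsRegularProfile.norm_pressureGrad_le (hp : IsRegularProfile R C f f₁ f₂)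
    (hγ : 1 ≤ γ) (hγ' : γ ≤ 2) (n : ℕ) {x : E3} (hx : x ∈ ballR R) :
    ‖pressureGrad γ f f₁ f₂ n x‖ ≤
      2 * (C ^ 2 * R ^ 2 + 2 * C) * ((n : ℝ) + 2) * ‖planar x‖ ^ n := by
  have hC := hp.nonneg
  have b2 : ‖pressureCoeff γ f f₁ ‖x‖ • (((n : ℝ) + 1) • harmonicField n x)‖ ≤
      2 * (C ^ 2 * R ^ 2 + 2 * C) * (((n : ℝ) + 1) * ‖planar x‖ ^ n) := by
    rw [norm_smul, norm_smul, norm_harmonicField, Real.norm_of_nonneg (by positivity : (0:ℝ) ≤ n + 1)]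
    gcongr
    exact (hp.abs_pressureCoeff_le hγ hγ' (norm_mem_Icc hx)).trans
      (by nlinarith [sq_nonneg (C * R)])
  have b1 : ‖(harmonicPoly n x * (pressureCoeffDeriv γ f f₁ f₂ ‖x‖ / ‖x‖)) • x‖ ≤
      2 * (C ^ 2 * R ^ 2 + 2 * C) * ‖planar x‖ ^ n := by
    rcases eq_or_ne x 0 with rfl | h0
    · simp only [smul_zero, norm_zero]
      positivity
    · have hx0 : 0 < ‖x‖ := norm_pos_iff.2 h0
      rw [norm_smul, norm_mul, norm_div, norm_norm, mul_assoc, div_mul_cancel₀ _ hx0.ne']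
      calc ‖harmonicPoly n x‖ * ‖pressureCoeffDeriv γ f f₁ f₂ ‖x‖‖
          ≤ (‖x‖ * ‖planar x‖ ^ n) * ‖pressureCoeffDeriv γ f f₁ f₂ ‖x‖‖ := by
            gcongr
            exact abs_harmonicPoly_le_norm_mul n x
        _ = (|pressureCoeffDeriv γ f f₁ f₂ ‖x‖| * ‖x‖) * ‖planar x‖ ^ n := by
            rw [Real.norm_eq_abs]; ring
        _ ≤ _ := by
            exact mul_le_mul_of_nonneg_right
              (hp.abs_pressureCoeffDeriv_mul_le hγ hγ' (norm_mem_Ioo hx h0)) (by positivity)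
  refine (norm_add_le _ _).trans ((add_le_add b1 b2).trans (le_of_eq ?_))
  ring

/-- The Jacobian of `f(|x|) • harmonicField n x`. -/
def momentumJac (f f₁ : ℝ → ℝ) (n : ℕ) (x : E3) : E3 →L[ℝ] E3 :=
  f ‖x‖ • harmonicJac n x +
    (innerSL ℝ ((f₁ ‖x‖ / ‖x‖) • x)).smulRight (harmonicField n x)

theorem divOf_momentumJac (f f₁ : ℝ → ℝ) (n : ℕ) (x : E3) :
    divOf (momentumJac f f₁ n) x = f₁ ‖x‖ / ‖x‖ * harmonicPoly n x := by
  have h : divOf (momentumJac f f₁ n) x = f ‖x‖ * divOf (harmonicJac n) x +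
      inner ℝ ((f₁ ‖x‖ / ‖x‖) • x) (harmonicField n x) := by
    rw [PiLp.inner_apply]
    simp only [divOf, Finset.mul_sum, ← Finset.sum_add_distrib]
    refine Finset.sum_congr rfl fun i _ => ?_
    simp only [momentumJac, add_apply, smul_apply, ContinuousLinearMap.smulRight_apply,
      innerSL_apply_apply, PiLp.add_apply, PiLp.smul_apply, smul_eq_mul]
    rw [real_inner_comm, inner_stdVec_left]
    simp [mul_comm]
  rw [h, divOf_harmonicJac, mul_zero, zero_add, inner_smul_left, inner_self_harmonicField]
  simp

theorem IsRegularProfile.hasFDerivAt_momentum (hp : IsRegularProfile R C f f₁ f₂) (n : ℕ) {x : E3}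
    (hx : x ∈ ballR R) :
    HasFDerivAt (fun y => density R f y • harmonicField n y) (momentumJac f f₁ n x) x := by
  have h := (hp.hasFDerivAt_norm hx).smul (hasFDerivAt_harmonicField n x)
  refine h.congr_of_eventuallyEq ?_
  filter_upwards [ballR_mem_nhds hx] with y hy
  simp [density_of_mem f hy]

theorem norm_planar_pow_le {x : E3} (hx : x ∈ ballR R) (n : ℕ) : ‖planar x‖ ^ n ≤ R ^ n :=
  pow_le_pow_left₀ (norm_nonneg _) ((norm_planar_le x).trans (norm_le_of_mem_ballR hx)) n

theorem IsRegularProfile.hasWeakFDerivOn_momentum (hp : IsRegularProfile R C f f₁ f₂) (n : ℕ) :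
    HasWeakFDerivOn (ballR R) (fun y => density R f y • harmonicField n y)
      (momentumJac f f₁ n) := by
  have hJc : Continuous (harmonicJac n) := by
    rw [← fderiv_harmonicField]
    exact (contDiff_harmonicField n).continuous_fderiv (by simp)
  obtain ⟨B, hB⟩ := exists_norm_le_on_closedBall hJc R
  have hfb : ∀ x ∈ ballR R, |f ‖x‖| ≤ f 0 := fun x hx => by
    rw [abs_of_nonneg (by linarith [hp.one_le _ (norm_mem_Icc hx)])]
    exact hp.le_zero _ (norm_mem_Icc hx)
  refine hasWeakFDerivOn_of_hasFDerivAt (C := max (f 0 * R ^ n) (f 0 * B + C * R * R ^ n))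
    Metric.isOpen_ball (measure_ball_lt_top (μ := (volume : Measure E3))).ne
    (fun x hx => hp.hasFDerivAt_momentum n hx) (fun x hx => ?_) (fun x hx => ?_)
  · refine le_trans ?_ (le_max_left _ _)
    rw [density_of_mem f hx, norm_smul, norm_harmonicField]
    exact mul_le_mul (hfb x hx) (norm_planar_pow_le hx n) (by positivity)
      ((abs_nonneg _).trans (hfb x hx))
  · refine le_trans ?_ (le_max_right _ _)
    refine (norm_add_le _ _).trans (add_le_add ?_ ?_)
    · rw [norm_smul]
      exact mul_le_mul (hfb x hx) (hB x (norm_le_of_mem_ballR hx)) (norm_nonneg _)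
        ((abs_nonneg _).trans (hfb x hx))
    · rw [ContinuousLinearMap.norm_smulRight_apply, innerSL_apply_norm, norm_harmonicField,
        norm_smul]
      have hR : 0 ≤ R := (norm_nonneg x).trans (norm_le_of_mem_ballR hx)
      have hC := hp.nonneg
      refine mul_le_mul ?_ (norm_planar_pow_le hx n) (by positivity) (by positivity)
      exact mul_le_mul (hp.abs_div_le (norm_mem_Icc hx)) (norm_le_of_mem_ballR hx) (norm_nonneg _) hC

theorem IsRegularProfile.aestronglyMeasurable_divOf (hp : IsRegularProfile R C f f₁ f₂) (n : ℕ) :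
    AEStronglyMeasurable (divOf (momentumJac f f₁ n)) (volume.restrict (ballR R)) := by
  have h1 : AEStronglyMeasurable (fun x : E3 => f₁ ‖x‖) (volume.restrict (ballR R)) :=
    (hp.continuousOn₁.comp continuous_norm.continuousOn
      fun x hx => norm_mem_Icc hx).aestronglyMeasurable Metric.isOpen_ball.measurableSet
  have h2 : AEStronglyMeasurable (fun x : E3 => ‖x‖⁻¹) (volume.restrict (ballR R)) :=
    Measurable.aestronglyMeasurable (by fun_prop)
  have h3 : Continuous (harmonicPoly n) :=
    Complex.continuous_re.comp (planar.continuous.pow (n + 1))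
  rw [funext (divOf_momentumJac f f₁ n)]
  simp only [div_eq_mul_inv]
  exact (h1.mul h2).mul h3.aestronglyMeasurable

theorem IsRegularProfile.abs_divOf_le (hp : IsRegularProfile R C f f₁ f₂) (n : ℕ) {x : E3}
    (hx : x ∈ ballR R) : |divOf (momentumJac f f₁ n) x| ≤ C * R * R ^ n := by
  have hR : 0 ≤ R := (norm_nonneg x).trans (norm_le_of_mem_ballR hx)
  rw [divOf_momentumJac, abs_mul, mul_assoc]
  refine mul_le_mul (hp.abs_div_le (norm_mem_Icc hx)) ?_ (abs_nonneg _) hp.nonneg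
  refine (abs_harmonicPoly_le_norm_mul n x).trans ?_
  exact mul_le_mul (norm_le_of_mem_ballR hx) (norm_planar_pow_le hx n) (by positivity) hR

end Radial

/-! ### The linearised operator on the harmonic fields -/

section Operator

variable {γ R C : ℝ} {f f₁ f₂ : ℝ → ℝ}

/-- The gradient of `𝒦 (∇·(ρ̄θ))` for `θ = harmonicField n`. The sign in `𝒦` is moved to the
density. -/
def interiorGrad (R : ℝ) (f f₁ : ℝ → ℝ) (n : ℕ) : E3 → E3 :=
  potentialGrad (volume.restrict (ballR R)) fun y => -divOf (momentumJac f f₁ n) y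

/-- The gradient of the boundary potential of `harmonicField n`. -/
def boundaryGrad (R : ℝ) (n : ℕ) : E3 → E3 :=
  potentialGrad (surfaceMeasure R) fun z => inner ℝ (harmonicField n z) (R⁻¹ • z)

/-- `𝐋θ` for `θ = harmonicField n`. -/
def linearisedField (γ R : ℝ) (f f₁ f₂ : ℝ → ℝ) (n : ℕ) (x : E3) : E3 :=
  -(pressureGrad γ f f₁ f₂ n x + interiorGrad R f f₁ n x + boundaryGrad R n x)

theorem potential_eq (g : E3 → ℝ) (x : E3) :
    potential R g x = ∫ y, -g y / ‖x - y‖ ∂(volume.restrict (ballR R)) := by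
  simp only [potential, neg_div, integral_neg]

theorem continuous_boundaryDensity (R : ℝ) (n : ℕ) :
    Continuous fun z : E3 => inner ℝ (harmonicField n z) (R⁻¹ • z) :=
  (contDiff_harmonicField n).continuous.inner (continuous_const_smul _)

theorem ae_abs_boundaryDensity_le (hR : 0 < R) (n : ℕ) :
    ∀ᵐ z ∂(surfaceMeasure R), |inner ℝ (harmonicField n z) (R⁻¹ • z)| ≤ R ^ n := by
  filter_upwards [ae_surfaceMeasure hR] with z hz
  refine (abs_real_inner_le_norm _ _).trans ?_
  rw [norm_smul, hz, norm_inv, Real.norm_of_nonneg hR.le, inv_mul_cancel₀ hR.ne', mul_one,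
    norm_harmonicField]
  exact pow_le_pow_left₀ (norm_nonneg _) ((norm_planar_le z).trans hz.le) n

theorem IsRegularProfile.ae_abs_divOf_le (hp : IsRegularProfile R C f f₁ f₂) (n : ℕ) :
    ∀ᵐ y ∂((volume : Measure E3).restrict (ballR R)),
      |-divOf (momentumJac f f₁ n) y| ≤ C * R * R ^ n := by
  filter_upwards [ae_restrict_mem Metric.isOpen_ball.measurableSet] with y hy
  rw [abs_neg]
  exact hp.abs_divOf_le n hy

theorem IsRegularProfile.hasFDerivAt_pressure_density (hp : IsRegularProfile R C f f₁ f₂)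
    (hγ : 1 ≤ γ) (hγ' : γ ≤ 2) {n : ℕ} (hn : n ≠ 0) {x : E3} (hx : x ∈ ballR R) :
    HasFDerivAt (fun y => γ * density R f y ^ (γ - 2) * divOf (momentumJac f f₁ n) y)
      (innerSL ℝ (pressureGrad γ f f₁ f₂ n x)) x := by
  refine (hp.hasFDerivAt_pressure hγ hγ' hn hx).congr_of_eventuallyEq ?_
  filter_upwards [ballR_mem_nhds hx] with y hy
  rw [density_of_mem f hy, divOf_momentumJac, pressureCoeff]
  ring

theorem IsRegularProfile.hasWeakFDerivOn_pressure (hp : IsRegularProfile R C f f₁ f₂)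
    (hγ : 1 ≤ γ) (hγ' : γ ≤ 2) {n : ℕ} (hn : n ≠ 0) :
    HasWeakFDerivOn (ballR R)
      (fun y => γ * density R f y ^ (γ - 2) * divOf (momentumJac f f₁ n) y)
      (fun x => innerSL ℝ (pressureGrad γ f f₁ f₂ n x)) := by
  have hC := hp.nonneg
  refine hasWeakFDerivOn_of_hasFDerivAt (C := max (2 * 1 * (C * R * R ^ n))
      (2 * (C ^ 2 * R ^ 2 + 2 * C) * ((n : ℝ) + 2) * R ^ n))
    Metric.isOpen_ball (measure_ball_lt_top (μ := (volume : Measure E3))).ne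
    (fun x hx => hp.hasFDerivAt_pressure_density hγ hγ' hn hx) (fun x hx => ?_) (fun x hx => ?_)
  · refine le_trans ?_ (le_max_left _ _)
    obtain ⟨h1, h2⟩ := hp.rpow_mem (norm_mem_Icc hx) (show γ - 2 ≤ 0 by linarith)
    rw [density_of_mem f hx, norm_mul, norm_mul, Real.norm_of_nonneg h1,
      Real.norm_of_nonneg (by linarith : 0 ≤ γ)]
    gcongr
    exact hp.abs_divOf_le n hx
  · refine le_trans ?_ (le_max_right _ _)
    rw [innerSL_apply_norm]
    refine (hp.norm_pressureGrad_le hγ hγ' n hx).trans ?_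
    gcongr
    exact (norm_planar_le x).trans (norm_le_of_mem_ballR hx)

theorem IsRegularProfile.memLp_pressureGrad (hp : IsRegularProfile R C f f₁ f₂)
    (hγ : 1 ≤ γ) (hγ' : γ ≤ 2) {n : ℕ} (hn : n ≠ 0) :
    MemLp (pressureGrad γ f f₁ f₂ n) 2 (volume.restrict (ballR R)) := by
  have hC := hp.nonneg
  have hm := aestronglyMeasurable_of_hasFDerivAt Metric.isOpen_ball
    (fun x hx => hp.hasFDerivAt_pressure hγ hγ' hn hx)
  have hm' : AEStronglyMeasurable (pressureGrad γ f f₁ f₂ n) (volume.restrict (ballR R)) :=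
    ((InnerProductSpace.toDual ℝ E3).symm.continuous.comp_aestronglyMeasurable hm).congr
      (Eventually.of_forall fun x => (InnerProductSpace.toDual ℝ E3).symm_apply_apply _)
  refine MemLp.of_bound hm' (2 * (C ^ 2 * R ^ 2 + 2 * C) * ((n : ℝ) + 2) * R ^ n) ?_
  filter_upwards [ae_restrict_mem Metric.isOpen_ball.measurableSet] with x hx
  refine (hp.norm_pressureGrad_le hγ hγ' n hx).trans ?_
  gcongr
  exact (norm_planar_le x).trans (norm_le_of_mem_ballR hx)

theorem IsRegularProfile.isLinearisedOp (hp : IsRegularProfile R C f f₁ f₂) (hR : 0 < R)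
    (hγ : 1 ≤ γ) (hγ' : γ ≤ 2) {n : ℕ} (hn : n ≠ 0)
    (h₁ : MemLp (interiorGrad R f f₁ n) 2 (volume.restrict (ballR R)))
    (h₂ : MemLp (boundaryGrad R n) 2 (volume.restrict (ballR R))) :
    IsLinearisedOp γ R f (harmonicField n) (linearisedField γ R f f₁ f₂ n) := by
  refine ⟨((hp.memLp_pressureGrad hγ hγ' hn).add h₁ |>.add h₂).neg, momentumJac f f₁ n,
    harmonicField n, hp.hasWeakFDerivOn_momentum n,
    hasTrace_of_contDiff (contDiff_harmonicField n) hR, ?_⟩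
  have w1 := hp.hasWeakFDerivOn_pressure hγ hγ' hn
  have w2 := hasWeakFDerivOn_potential (R := R) (hp.aestronglyMeasurable_divOf n).neg
    (hp.ae_abs_divOf_le n)
  have w3 := hasWeakFDerivOn_potential (R := R)
    (continuous_boundaryDensity R n).aestronglyMeasurable (ae_abs_boundaryDensity_le hR n)
  have hsum := (w1.add w2).add w3
  have e1 : (fun x => γ * density R f x ^ (γ - 2) * divOf (momentumJac f f₁ n) x +
      potential R (divOf (momentumJac f f₁ n)) x + boundaryPotential R (harmonicField n) x) =
      fun x => γ * density R f x ^ (γ - 2) * divOf (momentumJac f f₁ n) x +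
        (∫ y, -divOf (momentumJac f f₁ n) y / ‖x - y‖ ∂(volume.restrict (ballR R))) +
        ∫ z, inner ℝ (harmonicField n z) (R⁻¹ • z) / ‖x - z‖ ∂(surfaceMeasure R) := by
    funext x
    rw [potential_eq, boundaryPotential]
  have e2 : (fun x => innerSL ℝ (-(linearisedField γ R f f₁ f₂ n x))) =
      fun x => innerSL ℝ (pressureGrad γ f f₁ f₂ n x) + innerSL ℝ (interiorGrad R f f₁ n x) +
        innerSL ℝ (boundaryGrad R n x) := by
    funext x
    rw [linearisedField, neg_neg, map_add, map_add]
  rw [e1, e2]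
  exact hsum

theorem mul_le_sq_div_add {s t l : ℝ} (hl : 0 < l) :
    s * t ≤ 1 / (2 * l) * s ^ 2 + l / 2 * t ^ 2 := by
  have h : 1 / (2 * l) * s ^ 2 + l / 2 * t ^ 2 - s * t = (s - l * t) ^ 2 / (2 * l) := by
    field_simp
    ring
  have : 0 ≤ (s - l * t) ^ 2 / (2 * l) := by positivity
  linarith

theorem IsRegularProfile.abs_integrand_le (hp : IsRegularProfile R C f f₁ f₂)
    (hγ : 1 ≤ γ) (hγ' : γ ≤ 2) {n : ℕ} (hn : n ≠ 0) {l : ℝ} (hl : 0 < l) {x : E3}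
    (hx : x ∈ ballR R) :
    |density R f x * inner ℝ (linearisedField γ R f f₁ f₂ n x) (harmonicField n x)| ≤
      f 0 * (2 * (C ^ 2 * R ^ 2 + 2 * C) * ((n : ℝ) + 2) + l) * R ^ 2 *
          ‖planar x‖ ^ (2 * n - 2) +
        f 0 / (2 * l) * (‖interiorGrad R f f₁ n x‖ ^ 2 + ‖boundaryGrad R n x‖ ^ 2) := by
  have hC := hp.nonneg
  have hI := norm_mem_Icc hx
  have hf1 := hp.one_le _ hI
  have hf0 := hp.le_zero _ hI
  set w := ‖planar x‖ ^ n with hw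
  set K := 2 * (C ^ 2 * R ^ 2 + 2 * C) * ((n : ℝ) + 2) with hK
  have hK0 : 0 ≤ K := by positivity
  have hw0 : 0 ≤ w := by positivity
  have hw2 : w ^ 2 ≤ R ^ 2 * ‖planar x‖ ^ (2 * n - 2) := by
    have : w ^ 2 = ‖planar x‖ ^ 2 * ‖planar x‖ ^ (2 * n - 2) := by
      rw [hw, ← pow_mul, ← pow_add]; congr 1; omega
    rw [this]
    gcongr
    exact (norm_planar_le x).trans hI.2
  have hv : ‖linearisedField γ R f f₁ f₂ n x‖ ≤
      K * w + ‖interiorGrad R f f₁ n x‖ + ‖boundaryGrad R n x‖ := by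
    rw [linearisedField, norm_neg]
    refine (norm_add₃_le).trans ?_
    gcongr
    exact hp.norm_pressureGrad_le hγ hγ' n hx
  have h1 := mul_le_sq_div_add (s := ‖interiorGrad R f f₁ n x‖) (t := w) hl
  have h2 := mul_le_sq_div_add (s := ‖boundaryGrad R n x‖) (t := w) hl
  calc |density R f x * inner ℝ (linearisedField γ R f f₁ f₂ n x) (harmonicField n x)|
      ≤ f 0 * ((K * w + ‖interiorGrad R f f₁ n x‖ + ‖boundaryGrad R n x‖) * w) := by
        rw [abs_mul, density_of_mem f hx, abs_of_nonneg (by linarith)]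
        refine mul_le_mul hf0 ?_ (abs_nonneg _) (by linarith)
        refine (abs_real_inner_le_norm _ _).trans ?_
        rw [norm_harmonicField]
        exact mul_le_mul_of_nonneg_right hv hw0
    _ ≤ f 0 * ((K + l) * w ^ 2 +
          1 / (2 * l) * (‖interiorGrad R f f₁ n x‖ ^ 2 + ‖boundaryGrad R n x‖ ^ 2)) := by
        refine mul_le_mul_of_nonneg_left ?_ (by linarith)
        linarith
    _ ≤ f 0 * ((K + l) * (R ^ 2 * ‖planar x‖ ^ (2 * n - 2)) +
          1 / (2 * l) * (‖interiorGrad R f f₁ n x‖ ^ 2 + ‖boundaryGrad R n x‖ ^ 2)) := by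
        have : 0 ≤ f 0 := by linarith
        gcongr
    _ = _ := by ring

/-- The quadratic form on `harmonicField n` is at most of order `n` times `planarMoment R n`, up to
a contribution of the potentials. In the latter the parameter `l` balances the size of the field
against the `L²` norm of the gradients of the potentials, which is `O(Rⁿ)`. -/
theorem IsRegularProfile.exists_weightedInner_le (hp : IsRegularProfile R C f f₁ f₂) (hR : 0 < R)
    (hγ : 1 ≤ γ) (hγ' : γ ≤ 2) :
    ∃ a b E : ℝ, 0 ≤ a ∧ 0 < b ∧ 0 ≤ E ∧ ∀ n : ℕ, n ≠ 0 →
      IsLinearisedOp γ R f (harmonicField n) (linearisedField γ R f f₁ f₂ n) ∧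
      ∀ l : ℝ, 0 < l →
        weightedInner R f (linearisedField γ R f f₁ f₂ n) (harmonicField n) ≤
          (a * ((n : ℝ) + 2) + b * l) * planarMoment R n + E / l * R ^ (2 * n) := by
  have hC := hp.nonneg
  have hf0 : 1 ≤ f 0 := hp.one_le 0 ⟨le_rfl, hR.le⟩
  obtain ⟨C₁, hC₁, hb₁⟩ := exists_lintegral_ballR_rieszKernel_le (a := 3 / 2) (by norm_num)
    (by norm_num) R
  obtain ⟨C₂, hC₂, hb₂⟩ := exists_lintegral_surfaceMeasure_rieszKernel_le hR
  obtain ⟨K₁, hK₁, H₁⟩ := exists_integral_sq_potentialGrad_le _ hC₁ hb₁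
  obtain ⟨K₂, hK₂, H₂⟩ := exists_integral_sq_potentialGrad_le _ hC₂ hb₂
  refine ⟨f 0 * (2 * (C ^ 2 * R ^ 2 + 2 * C)) * R ^ 2, f 0 * R ^ 2,
    f 0 / 2 * (K₁ * (C * R) ^ 2 + K₂), by positivity, by positivity, by positivity,
    fun n hn => ?_⟩
  obtain ⟨m₁, i₁⟩ := H₁ _ (C * R * R ^ n) (by positivity) (hp.aestronglyMeasurable_divOf n).neg
    (hp.ae_abs_divOf_le n)
  obtain ⟨m₂, i₂⟩ := H₂ _ (R ^ n) (by positivity)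
    (continuous_boundaryDensity R n).aestronglyMeasurable (ae_abs_boundaryDensity_le hR n)
  change MemLp (interiorGrad R f f₁ n) 2 _ at m₁
  change MemLp (boundaryGrad R n) 2 _ at m₂
  change ∫ x in ballR R, ‖interiorGrad R f f₁ n x‖ ^ 2 ≤ _ at i₁
  change ∫ x in ballR R, ‖boundaryGrad R n x‖ ^ 2 ≤ _ at i₂
  refine ⟨hp.isLinearisedOp hR hγ hγ' hn m₁ m₂, fun l hl => ?_⟩
  have I₁ : IntegrableOn (fun x => ‖interiorGrad R f f₁ n x‖ ^ 2) (ballR R) :=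
    m₁.integrable_norm_pow (by norm_num)
  have I₂ : IntegrableOn (fun x => ‖boundaryGrad R n x‖ ^ 2) (ballR R) :=
    m₂.integrable_norm_pow (by norm_num)
  have I₀ : IntegrableOn (fun x : E3 => ‖planar x‖ ^ (2 * n - 2)) (ballR R) := by
    have hcont : Continuous fun x : E3 => ‖planar x‖ ^ (2 * n - 2) := by fun_prop
    exact (hcont.continuousOn.integrableOn_compact (isCompact_closedBall (0 : E3) R)).mono_set
      Metric.ball_subset_closedBall
  have I₁₂ := (I₁.add I₂).const_mul (f 0 / (2 * l))
  have I₀' := I₀.const_mul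
    (f 0 * (2 * (C ^ 2 * R ^ 2 + 2 * C) * ((n : ℝ) + 2) + l) * R ^ 2)
  have key := norm_integral_le_of_norm_le
    (f := fun x => density R f x *
      inner ℝ (linearisedField γ R f f₁ f₂ n x) (harmonicField n x)) (I₀'.add I₁₂)
    ((ae_restrict_mem Metric.isOpen_ball.measurableSet).mono
      fun x hx => hp.abs_integrand_le hγ hγ' hn hl hx)
  refine (le_abs_self _).trans (key.trans ?_)
  have e : ∫ x in ballR R, (f 0 * (2 * (C ^ 2 * R ^ 2 + 2 * C) * ((n : ℝ) + 2) + l) * R ^ 2 *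
          ‖planar x‖ ^ (2 * n - 2) +
        f 0 / (2 * l) * (‖interiorGrad R f f₁ n x‖ ^ 2 + ‖boundaryGrad R n x‖ ^ 2)) =
      f 0 * (2 * (C ^ 2 * R ^ 2 + 2 * C) * ((n : ℝ) + 2) + l) * R ^ 2 * planarMoment R n +
        f 0 / (2 * l) * ((∫ x in ballR R, ‖interiorGrad R f f₁ n x‖ ^ 2) +
          ∫ x in ballR R, ‖boundaryGrad R n x‖ ^ 2) := by
    rw [← integral_add I₁ I₂, planarMoment, ← integral_const_mul, ← integral_const_mul]
    exact integral_add I₀' I₁₂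
  refine e.le.trans ?_
  calc _ ≤ f 0 * (2 * (C ^ 2 * R ^ 2 + 2 * C) * ((n : ℝ) + 2) + l) * R ^ 2 * planarMoment R n +
        f 0 / (2 * l) * (K₁ * (C * R * R ^ n) ^ 2 + K₂ * (R ^ n) ^ 2) := by gcongr
    _ = _ := by
        rw [mul_comm 2 n, pow_mul]
        field_simp

end Operator

end LiquidStar

end

open LiquidStar in
theorem mainTheorem4 (γ R : ℝ) (f : ℝ → ℝ) (hγ : 1 ≤ γ) (hγ' : γ ≤ 2)
    (hf : LiquidStar.IsLaneEmdenProfile γ R f) :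
    ¬ ∃ c : ℝ, 0 < c ∧
      ∀ (θ v : LiquidStar.E3 → LiquidStar.E3)
        (J : LiquidStar.E3 → LiquidStar.E3 →L[ℝ] LiquidStar.E3),
        LiquidStar.MemH R θ J →
        LiquidStar.Irrotational R J →
        (∀ i : Fin 3, LiquidStar.weightedInner R f θ (fun _ => LiquidStar.stdVec i) = 0) →
        LiquidStar.IsLinearisedOp γ R f θ v →
        c * LiquidStar.gradNormSq R J ≤ LiquidStar.weightedInner R f v θ := by
  rintro ⟨c, hc, H⟩
  have hR := hf.radius_pos
  obtain ⟨C, f₁, f₂, hp⟩ := hf.exists_isRegularProfile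
  obtain ⟨a, b, E, ha, hb, hE, hop⟩ := hp.exists_weightedInner_le hR hγ hγ'
  obtain ⟨α, hα, hmom⟩ := exists_planarMoment_ge hR
  obtain ⟨N, hN⟩ := exists_nat_gt ((3 * a + E * b / (c * α)) / c)
  -- an odd degree, large enough to violate the resulting bound `c n ≤ 3 a + E b / (c α)`
  set n := 2 * N + 1 with hn
  have hn0 : n ≠ 0 := by omega
  have hn1 : (1 : ℝ) ≤ n := by exact_mod_cast Nat.one_le_iff_ne_zero.2 hn0
  have hNn : (N : ℝ) ≤ n := by exact_mod_cast (by omega : N ≤ n)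
  obtain ⟨hL, hle⟩ := hop n hn0
  have h1 := H _ _ _ (memH_harmonicField hR n) (irrotational_harmonicJac R n)
    (fun i => weightedInner_harmonicField_const R f ⟨N, hn⟩ _) hL
  -- this choice lets the term with `l` absorb exactly half of the left-hand side
  have h2 := h1.trans (hle (c * (n : ℝ) ^ 2 / b) (by positivity))
  rw [gradNormSq_harmonicJac] at h2
  have h3 := hmom n hn0
  set A := planarMoment R n with hA
  have hA0 : 0 < A := by
    have h4 : 0 < (n : ℝ) ^ 3 * A := lt_of_lt_of_le (by positivity) h3
    exact pos_of_mul_pos_right h4 (by positivity)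
  have h5 : E / (c * (n : ℝ) ^ 2 / b) * R ^ (2 * n) ≤ E * b / (c * α) * n * A := by
    calc E / (c * (n : ℝ) ^ 2 / b) * R ^ (2 * n)
        = E * b / (c * α * (n : ℝ) ^ 2) * (α * R ^ (2 * n)) := by field_simp
      _ ≤ E * b / (c * α * (n : ℝ) ^ 2) * ((n : ℝ) ^ 3 * A) := by gcongr
      _ = _ := by field_simp
  have h6 : b * (c * (n : ℝ) ^ 2 / b) = c * (n : ℝ) ^ 2 := by field_simp
  rw [h6] at h2
  have h7 : (c * (n : ℝ) ^ 2) * A ≤ (a * ((n : ℝ) + 2) + E * b / (c * α) * n) * A := by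
    linarith
  have h8 := le_of_mul_le_mul_right h7 hA0
  have h9 : a * ((n : ℝ) + 2) ≤ 3 * a * n := by nlinarith
  have h10 : (c * n) * n ≤ (3 * a + E * b / (c * α)) * n := by linarith
  have h11 : c * n ≤ 3 * a + E * b / (c * α) := le_of_mul_le_mul_right h10 (by linarith)
  rw [div_lt_iff₀ hc] at hN
  nlinarith
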